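/- Let $\Sigma$ be a finite alphabet. For $k\ge 1$, a two-way $k$-head nondeterministic finite automaton has a finite state set $Q$ with an initial, an accept and a reject state and a transition function $\delta\colon Q\times(\Sigma\sqcup\{\rhd,\lhd\})^k\to\mathcal P(Q\times\{\text{left},\text{stay},\text{right}\}^k)$. On input $x\in\Sigma^*$ it runs on the read-only tape $\rhd x\lhd$ with all $k$ heads initially on $\rhd$; a head that attempts to move beyond an end marker stays on it. A computational path halts when it reaches the accept or the reject state or when $\delta$ offers no further step, and $x$ is accepted if some path reaches the accept state. The automaton runs in linear time if every computational path on every input of length $n$ has at most $O(n)$ steps. For functions $f,g$, let $\mathrm{NTISP}(f(n),g(n))$ be the class of languages recognized by a nondeterministic Turing machine with a two-way read-only input tape (with end markers) and one read/write work tape, such that on every computational path on every input of length $n$ the same machine makes $O(f(n))$ steps and scans $O(g(n))$ work tape cells. Theorem. For every $k\ge 1$, every language $L\subseteq\Sigma^*$ that is recognized by a two-way $k$-head nondeterministic finite automaton running in linear time belongs to $$\mathrm{NTISP}\!\left(\frac{n^2}{\log n},\ \log n\right).$$ -/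

import Mathlib

/-- `ReachesIn step t c d`: some sequence of exactly `t` steps leads from `c` to `d`. -/
inductive ReachesIn {C : Type} (step : C → C → Prop) : ℕ → C → C → Prop
  | refl (c : C) : ReachesIn step 0 c c
  | tail {t : ℕ} {c d e : C} : ReachesIn step t c d → step d e → ReachesIn step (t + 1) c e

/-- The symbols of a read-only input tape: the two end markers and the input letters. -/
inductive InputSymbol (α : Type) : Type
  | leftEnd : InputSymbol α
  | rightEnd : InputSymbol α
  | letter : α → InputSymbol α

/-- The contents of cell `i` of the tape `▷ x ◁`: cell `0` holds `▷`, the cells `1, …, |x|` hold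
the letters of `x`, and cell `|x| + 1` holds `◁`. -/
def inputCell {α : Type} (x : List α) : ℕ → InputSymbol α
  | 0 => .leftEnd
  | i + 1 => match x[i]? with
    | some a => .letter a
    | none => .rightEnd

/-- Head movements: left, stay put, right. -/
inductive HeadMove : Type
  | left : HeadMove
  | stay : HeadMove
  | right : HeadMove

/-- The new position of a head at position `i` of the tape `▷ x ◁` with `|x| = n`. A head that
attempts to move beyond an end marker stays on it. -/
def HeadMove.onInput (n : ℕ) : HeadMove → ℕ → ℕ
  | .left, i => i - 1
  | .stay, i => i
  | .right, i => min (i + 1) (n + 1)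

/-- The new position of a head at cell `i` of a one-way infinite tape with cells `0, 1, 2, …`.
A head that attempts to move left from cell `0` stays there. -/
def HeadMove.onWork : HeadMove → ℕ → ℕ
  | .left, i => i - 1
  | .stay, i => i
  | .right, i => i + 1

/-! ### Two-way multi-head nondeterministic finite automata -/

/-- A two-way nondeterministic finite automaton with `k` heads over the input alphabet `α`. -/
structure TwoNFA (k : ℕ) (α : Type) where
  Q : Type
  finite_Q : Finite Q
  δ : Q → (Fin k → InputSymbol α) → Set (Q × (Fin k → HeadMove))
  q₀ : Q
  qacc : Q
  qrej : Q

namespace TwoNFA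

variable {k : ℕ} {α : Type}

/-- A configuration: the state and the head positions. -/
structure Cfg (M : TwoNFA k α) where
  state : M.Q
  pos : Fin k → ℕ

/-- The initial configuration. -/
def init (M : TwoNFA k α) : M.Cfg := ⟨M.q₀, fun _ => 0⟩

/-- One step on input `x`. No step leaves the accept state or the reject state. -/
def Step (M : TwoNFA k α) (x : List α) (c d : M.Cfg) : Prop :=
  c.state ≠ M.qacc ∧ c.state ≠ M.qrej ∧
    ∃ m : Fin k → HeadMove,
      (d.state, m) ∈ M.δ c.state (fun i => inputCell x (c.pos i)) ∧
        d.pos = fun i => (m i).onInput x.length (c.pos i)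

/-- `M` accepts `x` if some computational path on `x` reaches the accept state. -/
def Accepts (M : TwoNFA k α) (x : List α) : Prop :=
  ∃ t c, ReachesIn (M.Step x) t M.init c ∧ c.state = M.qacc

/-- The language recognized by `M`. -/
def language (M : TwoNFA k α) : Language α := {x | M.Accepts x}

/-- Every computational path on every input `x` has at most `T |x|` steps. -/
def RunsInTime (M : TwoNFA k α) (T : ℕ → ℕ) : Prop :=
  ∀ (x : List α) (t : ℕ) (c : M.Cfg), ReachesIn (M.Step x) t M.init c → t ≤ T x.length

end TwoNFA

/-- The languages over `α` that are recognized by a two-way nondeterministic finite automaton with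
`k` heads which runs for `O(f(n))` steps on every computational path on any input of length `n`. -/
def TwoNFATime (α : Type) (k : ℕ) (f : ℕ → ℝ) : Set (Language α) :=
  {L | ∃ (M : TwoNFA k α) (T : ℕ → ℕ),
    M.language = L ∧ M.RunsInTime T ∧
      Asymptotics.IsBigO Filter.atTop (fun n => (T n : ℝ)) f}

/-- The same with any positive number of heads. -/
def MultiheadNFATime (α : Type) (f : ℕ → ℝ) : Set (Language α) :=
  {L | ∃ k : ℕ, 0 < k ∧ L ∈ TwoNFATime α k f}

/-! ### Nondeterministic Turing machines with a read-only input tape -/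

/-- A nondeterministic Turing machine over the input alphabet `α`, with a two-way read-only input
tape (with end markers) and one read/write work tape with alphabet `Γ`. -/
structure NTM (α : Type) where
  Q : Type
  finite_Q : Finite Q
  Γ : Type
  finite_Γ : Finite Γ
  blank : Γ
  /-- Maps the state and the symbols under the input head and under the work head to the set of
  alternatives: new state, symbol written on the work tape, input head move, work head move. -/
  δ : Q → InputSymbol α → Γ → Set (Q × Γ × HeadMove × HeadMove)
  q₀ : Q
  qacc : Q
  qrej : Q
  qacc_ne_qrej : qacc ≠ qrej

namespace NTM

variable {α : Type}

/-- A configuration: the state, the two head positions and the contents of the work tape. -/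
structure Cfg (N : NTM α) where
  state : N.Q
  inPos : ℕ
  workPos : ℕ
  work : ℕ → N.Γ

/-- The initial configuration: the input head is on the left end marker, and the work head is on
the leftmost cell of a blank work tape. -/
def init (N : NTM α) : N.Cfg := ⟨N.q₀, 0, 0, fun _ => N.blank⟩

/-- One step on input `x`. No step leaves the accept state or the reject state. -/
def Step (N : NTM α) (x : List α) (c d : N.Cfg) : Prop :=
  c.state ≠ N.qacc ∧ c.state ≠ N.qrej ∧
    ∃ (b : N.Γ) (m₁ m₂ : HeadMove),
      (d.state, b, m₁, m₂) ∈ N.δ c.state (inputCell x c.inPos) (c.work c.workPos) ∧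
        d.inPos = m₁.onInput x.length c.inPos ∧
        d.workPos = m₂.onWork c.workPos ∧
        d.work = Function.update c.work c.workPos b

/-- `N` accepts `x` if some computational path on `x` reaches the accept state. -/
def Accepts (N : NTM α) (x : List α) : Prop :=
  ∃ t c, ReachesIn (N.Step x) t N.init c ∧ c.state = N.qacc

/-- The language recognized by `N`. -/
def language (N : NTM α) : Language α := {x | N.Accepts x}

/-- Every computational path on every input `x` has at most `T |x|` steps. -/
def RunsInTime (N : NTM α) (T : ℕ → ℕ) : Prop :=
  ∀ (x : List α) (t : ℕ) (c : N.Cfg), ReachesIn (N.Step x) t N.init c → t ≤ T x.length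

/-- Every computational path on every input `x` scans at most `S |x|` work tape cells. As the work
head starts on cell `0` and moves by at most one cell in a step, the cells that it scans on a path
form an initial segment of the tape, so this says that it never leaves the first `S |x|` cells. -/
def RunsInSpace (N : NTM α) (S : ℕ → ℕ) : Prop :=
  ∀ (x : List α) (t : ℕ) (c : N.Cfg),
    ReachesIn (N.Step x) t N.init c → c.workPos < S x.length

end NTM

/-- The languages over `α` that are recognized by a nondeterministic Turing machine which uses, on
every computational path on any input of length `n`, time `O(f(n))` and space `O(g(n))`
simultaneously. -/
def NTISP (α : Type) (f g : ℕ → ℝ) : Set (Language α) :=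
  {L | ∃ (N : NTM α) (T S : ℕ → ℕ),
    N.language = L ∧ N.RunsInTime T ∧ N.RunsInSpace S ∧
      Asymptotics.IsBigO Filter.atTop (fun n => (T n : ℝ)) f ∧
      Asymptotics.IsBigO Filter.atTop (fun n => (S n : ℝ)) g}

/-! The Turing machine simulates the automaton in blocks of `blockLen n`, about `log n`, steps. It
guesses for every step of a block what each head reads and how it moves, and writes these records on
a work tape of that many cells. While guessing it checks the state sequence. It then treats the
heads one at a time: it brings its single input head to the stored position of the simulated head,
replays the records against the input, and walks back to the left end while measuring the new
position. Records that pass for all heads describe a genuine path of the automaton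
(`reaches_of_runs`), and every path yields such records (`runs_of_reaches`).

The saving comes from the walk. A position is stored as `v * blockLen n + r`, with `v` in binary and
`r` as a number of marks. A sweep over the work tape changes `v` by one and moves the input head by
one cell per work cell, so the cost of updating the counter is absorbed in the walk. One head thus
takes `O(n / log n)` sweeps of `O(log n)` steps in each block. Linear time means `O(n / log n)`
blocks, hence `O((n / log n) ^ 2)` sweeps and `O(n ^ 2 / log n)` steps.

The bound must hold on all paths, including those with wrong guesses. Walks are limited by the end
markers, and a new block starts only after the previous one is verified, so the number of blocks is
limited by the running time of the automaton. The invariant `SimInv` carries both soundness and this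
accounting (`SimInv.step`, `SimInv.bounds`); `sim_reaches_acc` gives completeness. `Sweeper`
separates all this from the mechanics of the Turing machine, which `accepts_of_reaches`,
`reaches_of_accepts` and `runs_bounds` handle once and for all. -/

namespace ReachesIn

/-! ### Paths with a step count -/

variable {C : Type} {step : C → C → Prop}

theorem trans {s t : ℕ} {c d e : C} (h₁ : ReachesIn step s c d) (h₂ : ReachesIn step t d e) :
    ReachesIn step (s + t) c e := by
  induction h₂ with
  | refl => exact h₁
  | tail _ hs ih => exact .tail (ih h₁) hs

theorem single {c d : C} (h : step c d) : ReachesIn step 1 c d := .tail (.refl c) h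

theorem iff_reflTransGen {c d : C} :
    (∃ t, ReachesIn step t c d) ↔ Relation.ReflTransGen step c d := by
  constructor
  · rintro ⟨t, h⟩
    induction h with
    | refl => exact .refl
    | tail _ hs ih => exact ih.tail hs
  · intro h
    induction h with
    | refl => exact ⟨0, .refl c⟩
    | tail _ hs ih => exact ⟨_, .tail ih.choose_spec hs⟩

/-- A path of `s + t` steps splits after `s` steps. -/
theorem split {s t : ℕ} {c e : C} (h : ReachesIn step (s + t) c e) :
    ∃ d, ReachesIn step s c d ∧ ReachesIn step t d e := by
  induction t generalizing e with
  | zero => exact ⟨e, h, .refl e⟩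
  | succ t ih =>
    cases h with
    | tail h hs =>
      obtain ⟨d, h₁, h₂⟩ := ih h
      exact ⟨d, h₁, .tail h₂ hs⟩

end ReachesIn

/-! ### Sweeping machines -/

/-- A machine whose work head sweeps over the word on the work tape from left to right, acting on
each cell as a nondeterministic transducer that also controls the input head, possibly appends one
cell, and returns to the left end. -/
structure Sweeper (α : Type) where
  /-- Control states, assumed at the left end of the work tape. -/
  P : Type
  finite_P : Finite P
  /-- Sweep states. -/
  A : Type
  finite_A : Finite A
  /-- Cell contents. -/
  D : Type
  finite_D : Finite D
  /-- How a sweep may start. -/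
  start : P → InputSymbol α → A → HeadMove → Prop
  /-- How a cell may be processed. -/
  cell : A → InputSymbol α → D → A → D → HeadMove → Prop
  /-- How a sweep may finish at the right end, possibly with a new cell. -/
  finish : A → InputSymbol α → P → Option D → Prop
  p₀ : P
  pacc : P

namespace Sweeper

variable {α : Type} (S : Sweeper α) (x : List α)

/-- A configuration between two sweeps. -/
structure Cfg where
  state : S.P
  inPos : ℕ
  word : List S.D

/-- The initial configuration: the word is empty. -/
def init : S.Cfg := ⟨S.p₀, 0, []⟩

/-- The effect of the transducer on a word, the input head moving along. -/
inductive Sweep : S.A → ℕ → List S.D → S.A → ℕ → List S.D → Prop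
  | nil (a : S.A) (p : ℕ) : Sweep a p [] a p []
  | cons {a a₁ a' : S.A} {p p' : ℕ} {d d' : S.D} {w w' : List S.D} {mv : HeadMove} :
      S.cell a (inputCell x p) d a₁ d' mv → Sweep a₁ (mv.onInput x.length p) w a' p' w' →
      Sweep a p (d :: w) a' p' (d' :: w')

/-- One sweep. -/
def Step (c d : S.Cfg) : Prop :=
  c.state ≠ S.pacc ∧ ∃ a mv a' w' o, S.start c.state (inputCell x c.inPos) a mv ∧
    S.Sweep x a (mv.onInput x.length c.inPos) c.word a' d.inPos w' ∧
    S.finish a' (inputCell x d.inPos) d.state o ∧ d.word = w' ++ o.toList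

variable {S x}

theorem Sweep.length_eq {a a' : S.A} {p p' : ℕ} {w w' : List S.D} (h : S.Sweep x a p w a' p' w') :
    w'.length = w.length := by
  induction h with
  | nil => rfl
  | cons _ _ ih => simp [ih]

theorem Sweep.of_nil {a a' : S.A} {p p' : ℕ} {w' : List S.D} (h : S.Sweep x a p [] a' p' w') :
    a' = a ∧ p' = p ∧ w' = [] := by
  cases h; exact ⟨rfl, rfl, rfl⟩

theorem Sweep.of_cons {a a' : S.A} {p p' : ℕ} {d : S.D} {w w' : List S.D}
    (h : S.Sweep x a p (d :: w) a' p' w') :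
    ∃ a₁ d' mv v, S.cell a (inputCell x p) d a₁ d' mv ∧
      S.Sweep x a₁ (mv.onInput x.length p) w a' p' v ∧ w' = d' :: v := by
  cases h with
  | cons hc hs => exact ⟨_, _, _, _, hc, hs, rfl⟩

theorem Sweep.snoc {a a₁ a' : S.A} {p p₁ : ℕ} {w w' : List S.D} {d d' : S.D} {mv : HeadMove}
    (h : S.Sweep x a p w a₁ p₁ w') (hc : S.cell a₁ (inputCell x p₁) d a' d' mv) :
    S.Sweep x a p (w ++ [d]) a' (mv.onInput x.length p₁) (w' ++ [d']) := by
  induction h with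
  | nil => exact .cons hc (.nil _ _)
  | cons h₁ _ ih => exact .cons h₁ (ih hc)

/-- Work tape symbols of the Turing machine of a sweeping machine. -/
inductive Symbol (D : Type) : Type
  | blank : Symbol D
  | left : Symbol D
  | data : D → Symbol D

/-- States of the Turing machine of a sweeping machine. -/
inductive State (P A : Type) : Type
  | ret : P → State P A
  | swp : A → State P A
  | rej : State P A

theorem Symbol.finite (D : Type) [Finite D] : Finite (Symbol D) :=
  Finite.of_injective
    (fun s : Symbol D => match s with
      | .blank => (Sum.inl true : Bool ⊕ D)
      | .left => Sum.inl false
      | .data d => Sum.inr d)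
    (by rintro (_ | _ | _) (_ | _ | _) <;> simp)

theorem State.finite (P A : Type) [Finite P] [Finite A] : Finite (State P A) :=
  Finite.of_injective
    (fun s : State P A => match s with
      | .ret p => (some (Sum.inl p) : Option (P ⊕ A))
      | .swp a => some (Sum.inr a)
      | .rej => none)
    (by rintro (_ | _ | _) (_ | _ | _) <;> simp)

variable (S)

/-- The transitions of the Turing machine of a sweeping machine. -/
inductive Trans : State S.P S.A → InputSymbol α → Symbol S.D →
    State S.P S.A × Symbol S.D × HeadMove × HeadMove → Prop
  | boot (p s) : Trans (.ret p) s .blank (.ret p, .left, .stay, .stay)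
  | ret (p s d) : Trans (.ret p) s (.data d) (.ret p, .data d, .stay, .left)
  | start {p s a mv} : S.start p s a mv → Trans (.ret p) s .left (.swp a, .left, mv, .right)
  | cell {a s d a' d' mv} : S.cell a s d a' d' mv →
      Trans (.swp a) s (.data d) (.swp a', .data d', mv, .right)
  | finish {a s p o} : S.finish a s p o →
      Trans (.swp a) s .blank (.ret p, o.elim .blank .data, .stay, .left)

/-- The Turing machine of a sweeping machine. -/
def toNTM : NTM α where
  Q := State S.P S.A
  finite_Q := haveI := S.finite_P; haveI := S.finite_A; State.finite _ _
  Γ := Symbol S.D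
  finite_Γ := haveI := S.finite_D; Symbol.finite _
  blank := .blank
  δ := fun q s g => {r | S.Trans q s g r}
  q₀ := .ret S.p₀
  qacc := .ret S.pacc
  qrej := .rej
  qacc_ne_qrej := by simp

variable {S}

/-- The work tape that holds the word `w` to the right of the left marker. -/
def tape {D : Type} (w : List D) : ℕ → Symbol D
  | 0 => .left
  | j + 1 => match w[j]? with
    | some d => .data d
    | none => .blank

theorem tape_append_cons {D : Type} (u v : List D) (d : D) :
    tape (u ++ d :: v) (u.length + 1) = .data d := by
  simp [tape]

theorem tape_length {D : Type} (u : List D) : tape u (u.length + 1) = .blank := by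
  simp [tape]

theorem tape_of_pos_of_le {D : Type} (w : List D) {h : ℕ} (h₀ : 0 < h) (hw : h ≤ w.length) :
    ∃ d, tape w h = .data d := by
  obtain ⟨j, rfl⟩ := Nat.exists_eq_succ_of_ne_zero h₀.ne'
  exact ⟨w[j], by simp [tape, List.getElem?_eq_getElem (Nat.lt_of_succ_le hw)]⟩

theorem update_tape {D : Type} (u v : List D) (d d' : D) :
    Function.update (tape (u ++ d :: v)) (u.length + 1) (.data d') = tape (u ++ d' :: v) := by
  funext j
  rcases eq_or_ne j (u.length + 1) with rfl | hj
  · simp [tape]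
  · rw [Function.update_of_ne hj]
    cases j with
    | zero => rfl
    | succ j =>
      have hj' : j ≠ u.length := fun h => hj (by rw [h])
      have : (u ++ d :: v)[j]? = (u ++ d' :: v)[j]? := by
        simp only [List.getElem?_append]
        split
        · rfl
        · obtain ⟨i, hi⟩ : ∃ i, j - u.length = i + 1 := ⟨j - u.length - 1, by omega⟩
          simp [hi]
      simp only [tape, this]

theorem update_tape_length {D : Type} (u : List D) (o : Option D) :
    Function.update (tape u) (u.length + 1) (o.elim .blank .data) = tape (u ++ o.toList) := by
  funext j
  rcases eq_or_ne j (u.length + 1) with rfl | hj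
  · cases o <;> simp [tape]
  · rw [Function.update_of_ne hj]
    cases j with
    | zero => rfl
    | succ j =>
      have hj' : j ≠ u.length := fun h => hj (by rw [h])
      have : u[j]? = (u ++ o.toList)[j]? := by
        simp only [List.getElem?_append]
        split
        · rfl
        · obtain ⟨i, hi⟩ : ∃ i, j - u.length = i + 1 := ⟨j - u.length - 1, by omega⟩
          cases o <;> simp [hi] <;> omega
      simp only [tape, this]

/-! #### Sweeps are carried out by the Turing machine -/

/-- The Turing machine configuration with work tape `tape w`. -/
def cfg (q : State S.P S.A) (p h : ℕ) (w : List S.D) : S.toNTM.Cfg := ⟨q, p, h, tape w⟩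

theorem mk_eq_cfg {q : State S.P S.A} {p p' h h' : ℕ} {f : ℕ → Symbol S.D} {w : List S.D}
    (hp : p = p') (hh : h = h') (hf : f = tape w) :
    (⟨q, p, h, f⟩ : S.toNTM.Cfg) = cfg q p' h' w := by
  subst hp hh hf; rfl

/-- The work tape starts entirely blank, so a first extra step must put the left marker into cell
`0`. -/
theorem boot_step (hp : S.p₀ ≠ S.pacc) :
    S.toNTM.Step x S.toNTM.init (cfg (.ret S.p₀) 0 0 []) := by
  refine ⟨fun h => hp (State.ret.inj h), nofun,
    .left, .stay, .stay, Trans.boot _ _, rfl, rfl, ?_⟩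
  funext j
  cases j <;> rfl

theorem reaches_ret {q : S.P} (hq : q ≠ S.pacc) (p : ℕ) (w : List S.D) (h : ℕ) (hh : h ≤ w.length) :
    Relation.ReflTransGen (S.toNTM.Step x) (cfg (.ret q) p h w) (cfg (.ret q) p 0 w) := by
  induction h with
  | zero => exact .refl
  | succ h ih =>
    refine .head (b := cfg (.ret q) p h w) ⟨fun h => hq (State.ret.inj h), nofun,
      .data w[h], .stay, .left, ?_, rfl, rfl, ?_⟩ (ih (by omega))
    · have : tape w (h + 1) = .data w[h] := by simp [tape, List.getElem?_eq_getElem hh]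
      exact this ▸ Trans.ret _ _ _
    · refine (Function.update_eq_self_iff.2 ?_).symm
      simp only [cfg, tape, List.getElem?_eq_getElem hh]
      rfl

/-- The prefix `u` is the part of the tape already rewritten; it grows by one cell in each induction
step. -/
theorem reaches_sweep {a a' : S.A} {p p' : ℕ} {v v' : List S.D} (h : S.Sweep x a p v a' p' v')
    (u : List S.D) :
    Relation.ReflTransGen (S.toNTM.Step x) (cfg (.swp a) p (u.length + 1) (u ++ v))
      (cfg (.swp a') p' (u.length + v.length + 1) (u ++ v')) := by
  induction h generalizing u with
  | nil => exact .refl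
  | @cons a a₁ a' p p' d d' w w' mv hc _ ih =>
    have := ih (u ++ [d'])
    simp only [List.append_assoc, List.singleton_append, List.length_append, List.length_cons,
      List.length_nil, zero_add] at this
    refine .head (b := cfg (.swp a₁) (mv.onInput x.length p) (u.length + 1 + 1) (u ++ d' :: w))
      ⟨nofun, nofun, .data d', mv, .right, ?_, rfl, rfl, ?_⟩ ?_
    · have := tape_append_cons u w d
      simp only [cfg, this]
      exact Trans.cell hc
    · exact (update_tape u w d d').symm
    · convert this using 2
      simp only [List.length_cons]; omega

theorem reaches_step {c d : S.Cfg} (h : S.Step x c d) :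
    Relation.ReflTransGen (S.toNTM.Step x) (cfg (.ret c.state) c.inPos 0 c.word)
      (cfg (.ret d.state) d.inPos c.word.length d.word) := by
  obtain ⟨hne, a, mv, a', w', o, hs, hsw, hf, hw⟩ := h
  have h₁ : S.toNTM.Step x (cfg (.ret c.state) c.inPos 0 c.word)
      (cfg (.swp a) (mv.onInput x.length c.inPos) 1 c.word) := by
    refine ⟨fun h => hne (State.ret.inj h), nofun, .left, mv, .right,
      Trans.start hs, rfl, rfl, ?_⟩
    exact (Function.update_eq_self_iff.2 rfl).symm
  have h₂ := reaches_sweep hsw []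
  have hl := hsw.length_eq
  refine .head h₁ (h₂.tail ?_)
  refine ⟨nofun, nofun, o.elim .blank .data, .stay, .left, ?_, rfl, ?_, ?_⟩
  · have : tape w' (c.word.length + 1) = .blank := hl ▸ tape_length w'
    simp only [cfg, List.length_nil, zero_add, List.nil_append, this]
    exact Trans.finish hf
  · simp [cfg, HeadMove.onWork]
  · simp only [cfg, List.length_nil, zero_add, List.nil_append, hw, ← hl]
    exact (update_tape_length w' o).symm

theorem length_le_of_step {c d : S.Cfg} (h : S.Step x c d) : c.word.length ≤ d.word.length := by
  obtain ⟨-, a, mv, a', w', o, -, hsw, -, hw⟩ := h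
  simp [hw, hsw.length_eq]

theorem accepts_of_reaches (hp : S.p₀ ≠ S.pacc) {c : S.Cfg}
    (h : Relation.ReflTransGen (S.Step x) S.init c) (hc : c.state = S.pacc) :
    S.toNTM.Accepts x := by
  -- The work head is left at some cell `h`: it returns only when a further sweep follows, because
  -- no step leaves an accepting state.
  have key : ∀ d, Relation.ReflTransGen (S.Step x) S.init d → ∃ h ≤ d.word.length,
      Relation.ReflTransGen (S.toNTM.Step x) S.toNTM.init (cfg (.ret d.state) d.inPos h d.word) := by
    intro d hd
    induction hd with
    | refl => exact ⟨0, le_rfl, .single (boot_step hp)⟩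
    | tail _ hs ih =>
      obtain ⟨h, hh, ih⟩ := ih
      exact ⟨_, length_le_of_step hs, (ih.trans (reaches_ret hs.1 _ _ _ hh)).trans (reaches_step hs)⟩
  obtain ⟨j, -, hj⟩ := key c h
  obtain ⟨t, ht⟩ := ReachesIn.iff_reflTransGen.2 hj
  exact ⟨t, _, ht, congrArg State.ret hc⟩

/-! #### The Turing machine does nothing else -/

/-- What the Turing machine may be doing after `t` steps. -/
inductive Tracks (S : Sweeper α) (x : List α) (L : ℕ) : ℕ → S.toNTM.Cfg → Prop
  | init : Tracks S x L 0 S.toNTM.init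
  | ret {t m h : ℕ} {c : S.Cfg} : ReachesIn (S.Step x) m S.init c → h ≤ c.word.length →
      t + h ≤ 1 + m * (2 * L + 2) → Tracks S x L t (cfg (.ret c.state) c.inPos h c.word)
  | swp {t m : ℕ} {c : S.Cfg} {a a' : S.A} {mv : HeadMove} {p : ℕ} {u u' v : List S.D} :
      ReachesIn (S.Step x) m S.init c → c.state ≠ S.pacc →
      S.start c.state (inputCell x c.inPos) a mv →
      S.Sweep x a (mv.onInput x.length c.inPos) u a' p u' → c.word = u ++ v →
      t ≤ 2 + m * (2 * L + 2) + u.length →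
      Tracks S x L t (cfg (.swp a') p (u.length + 1) (u' ++ v))

/-- On a word of length at most `L`, a sweep costs one step to start, `L` for the cells, one to
finish and `L` to return, which is `2 * L + 2`; the extra `1` pays for writing the left marker.
Bounding `t + h` during the return charges the remaining `h` moves in advance. -/
theorem Tracks.step {L t : ℕ} {c d : S.toNTM.Cfg}
    (hL : ∀ m c, ReachesIn (S.Step x) m S.init c → c.word.length ≤ L)
    (h : Tracks S x L t c) (hs : S.toNTM.Step x c d) : Tracks S x L (t + 1) d := by
  obtain ⟨hacc, -, b, m₁, m₂, hδ, h₁, h₂, h₃⟩ := hs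
  obtain ⟨q', p', h', w'⟩ := d
  simp only at hδ h₁ h₂ h₃
  subst h₁ h₂ h₃
  cases h with
  | init =>
    generalize hg : (⟨q', b, m₁, m₂⟩ : _ × _ × _ × _) = r at hδ
    cases hδ with
    | boot =>
      obtain ⟨rfl, rfl, rfl, rfl⟩ := by simpa using hg
      convert Tracks.ret (L := L) (t := 1) (h := 0) (.refl S.init) (Nat.zero_le _) (by simp) using 1
      refine congrArg (NTM.Cfg.mk _ _ _) ?_
      funext j
      cases j <;> rfl
  | @ret _ m h c hc hh ht =>
    have hacc' : c.state ≠ S.pacc := fun h => hacc (congrArg State.ret h)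
    generalize hg : (⟨q', b, m₁, m₂⟩ : _ × _ × _ × _) = r at hδ
    generalize hy : (cfg (State.ret c.state) c.inPos h c.word).work
      (cfg (State.ret c.state) c.inPos h c.word).workPos = y at hδ
    have hy' : tape c.word h = y := hy
    have hupd : Function.update (tape c.word) h y = tape c.word :=
      Function.update_eq_self_iff.2 hy'.symm
    rcases Nat.eq_zero_or_pos h with rfl | h₀
    · cases hy'
      cases hδ with
      | start hst =>
        obtain ⟨rfl, rfl, rfl, rfl⟩ := by simpa using hg
        convert Tracks.swp (L := L) (t := t + 1) hc hacc' hst (.nil _ _) (List.nil_append _).symm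
          (by simp; omega) using 1
        exact mk_eq_cfg rfl rfl hupd
    · obtain ⟨d, hd⟩ := tape_of_pos_of_le c.word h₀ hh
      rw [hd] at hy'
      subst hy'
      cases hδ with
      | ret =>
        obtain ⟨rfl, rfl, rfl, rfl⟩ := by simpa using hg
        convert Tracks.ret (L := L) (t := t + 1) (h := h - 1) hc (by omega) (by omega) using 1
        exact mk_eq_cfg rfl rfl hupd
  | @swp _ m c a a' mv p u u' v hc hne hst hsw hw ht =>
    generalize hg : (⟨q', b, m₁, m₂⟩ : _ × _ × _ × _) = r at hδ
    have hl := hsw.length_eq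
    cases v with
    | cons d v =>
      have hy : (cfg (S := S) (State.swp a') p (u.length + 1) (u' ++ d :: v)).work
        (cfg (S := S) (State.swp a') p (u.length + 1) (u' ++ d :: v)).workPos = .data d := by
        rw [← hl]; exact tape_append_cons _ _ _
      rw [hy] at hδ
      cases hδ with
      | @cell _ _ _ a'' d' mv' hcell =>
        obtain ⟨rfl, rfl, rfl, rfl⟩ := by simpa using hg
        convert Tracks.swp (L := L) (t := t + 1) (v := v) hc hne hst (hsw.snoc hcell) (by simp [hw])
          (by simp; omega) using 1
        refine mk_eq_cfg rfl (by simp [cfg, HeadMove.onWork]) ?_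
        simp only [cfg, ← hl]
        exact (update_tape _ _ _ _).trans (by simp)
    | nil =>
      have hy : (cfg (S := S) (State.swp a') p (u.length + 1) (u' ++ [])).work
        (cfg (S := S) (State.swp a') p (u.length + 1) (u' ++ [])).workPos = .blank := by
        rw [← hl, List.append_nil]; exact tape_length _
      rw [hy] at hδ
      cases hδ with
      | @finish _ _ p' o hf =>
        obtain ⟨rfl, rfl, rfl, rfl⟩ := by simpa using hg
        rw [List.append_nil] at hw
        subst hw
        have hstep : S.Step x c ⟨p', p, u' ++ o.toList⟩ :=
          ⟨hne, a, mv, a', u', o, hst, hsw, hf, rfl⟩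
        have hcL := hL _ _ hc
        convert Tracks.ret (L := L) (t := t + 1) (h := c.word.length) (hc.tail hstep)
          (by simp [hl]) (by rw [add_mul]; omega) using 1
        refine mk_eq_cfg rfl (by simp [cfg, HeadMove.onWork]) ?_
        simp only [cfg, ← hl, List.append_nil]
        exact update_tape_length _ _

theorem tracks_of_reaches {L t : ℕ} {c : S.toNTM.Cfg}
    (hL : ∀ m c, ReachesIn (S.Step x) m S.init c → c.word.length ≤ L)
    (h : ReachesIn (S.toNTM.Step x) t S.toNTM.init c) : Tracks S x L t c := by
  generalize hc₀ : S.toNTM.init = c₀ at h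
  induction h with
  | refl => exact hc₀ ▸ .init
  | tail _ hs ih => exact (ih hc₀).step hL hs

theorem reaches_of_accepts (hp : S.p₀ ≠ S.pacc) {L : ℕ}
    (hL : ∀ m c, ReachesIn (S.Step x) m S.init c → c.word.length ≤ L)
    (h : S.toNTM.Accepts x) : ∃ m c, ReachesIn (S.Step x) m S.init c ∧ c.state = S.pacc := by
  obtain ⟨t, c, hc, hq⟩ := h
  cases tracks_of_reaches hL hc with
  | init => exact absurd (State.ret.inj hq) hp
  | ret hm => exact ⟨_, _, hm, State.ret.inj hq⟩
  | swp => exact absurd hq nofun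

/-- The factor is `N + 1` because a sweep may get stuck halfway and then is not counted among the
`N` completed ones. Besides the word, the head visits the left marker and the blank just after the
word. -/
theorem runs_bounds {L N : ℕ} {t : ℕ} {c : S.toNTM.Cfg}
    (hL : ∀ m c, ReachesIn (S.Step x) m S.init c → c.word.length ≤ L ∧ m ≤ N)
    (h : ReachesIn (S.toNTM.Step x) t S.toNTM.init c) :
    t ≤ (N + 1) * (2 * L + 2) + 1 ∧ c.workPos < L + 2 := by
  have hmul : ∀ m ≤ N, m * (2 * L + 2) ≤ N * (2 * L + 2) := fun m hm => Nat.mul_le_mul_right _ hm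
  cases tracks_of_reaches (fun m c hm => (hL m c hm).1) h with
  | init => exact ⟨Nat.zero_le _, by simp [NTM.init]⟩
  | ret hm hh ht =>
    have := hL _ _ hm
    have := hmul _ this.2
    exact ⟨by rw [add_mul]; omega, by simp [cfg]; omega⟩
  | @swp _ m c a a' mv p u u' v hm _ _ _ hw ht =>
    have := hL _ _ hm
    have h₂ := hmul _ this.2
    have : u.length ≤ c.word.length := by simp [hw]
    exact ⟨by rw [add_mul]; omega, by simp [cfg]; omega⟩

end Sweeper

/-! ### Input tapes and binary counters -/

theorem inputCell_eq_leftEnd_iff {α : Type} (x : List α) (p : ℕ) :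
    inputCell x p = .leftEnd ↔ p = 0 := by
  cases p with
  | zero => simp [inputCell]
  | succ p => simp only [inputCell]; split <;> simp

theorem inputCell_eq_rightEnd_iff {α : Type} (x : List α) (p : ℕ) :
    inputCell x p = .rightEnd ↔ x.length < p := by
  cases p with
  | zero => simp [inputCell]
  | succ p =>
    simp only [inputCell]
    split
    · rename_i h
      have := (List.getElem?_eq_some_iff.1 h).1
      simp; omega
    · rename_i h
      simpa [Nat.lt_succ_iff] using h

theorem HeadMove.onInput_le {n p : ℕ} (m : HeadMove) (h : p ≤ n + 1) : m.onInput n p ≤ n + 1 := by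
  cases m <;> simp only [HeadMove.onInput] <;> omega

theorem HeadMove.right_onInput {α : Type} {x : List α} {p : ℕ} (h : inputCell x p ≠ .rightEnd) :
    HeadMove.right.onInput x.length p = p + 1 ∧ p + 1 ≤ x.length + 1 := by
  rw [ne_eq, inputCell_eq_rightEnd_iff] at h
  simp only [HeadMove.onInput]; omega

theorem HeadMove.left_onInput {α : Type} {x : List α} {p : ℕ} (h : inputCell x p ≠ .leftEnd) :
    HeadMove.left.onInput x.length p + 1 = p := by
  rw [ne_eq, inputCell_eq_leftEnd_iff] at h
  simp only [HeadMove.onInput]; omega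

theorem InputSymbol.finite (α : Type) [Finite α] : Finite (InputSymbol α) :=
  Finite.of_injective
    (fun s : InputSymbol α => match s with
      | .leftEnd => (Sum.inl true : Bool ⊕ α)
      | .rightEnd => Sum.inl false
      | .letter a => Sum.inr a)
    (by rintro (_ | _ | _) (_ | _ | _) <;> simp)

theorem HeadMove.finite : Finite HeadMove :=
  Finite.of_injective
    (fun s : HeadMove => match s with
      | .left => (some true : Option Bool)
      | .right => some false
      | .stay => none)
    (by rintro (_ | _ | _) (_ | _ | _) <;> simp)

/-- The value of a binary number, least significant bit first. -/
def binVal : List Bool → ℕ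
  | [] => 0
  | b :: w => b.toNat + 2 * binVal w

theorem binVal_lt (w : List Bool) : binVal w < 2 ^ w.length := by
  induction w with
  | nil => simp [binVal]
  | cons b w ih => cases b <;> simp [binVal, pow_succ] <;> omega

theorem binVal_append_singleton (w : List Bool) (b : Bool) :
    binVal (w ++ [b]) = binVal w + 2 ^ w.length * b.toNat := by
  induction w with
  | nil => simp [binVal]
  | cons c w ih => simp [binVal, ih, pow_succ]; ring

theorem binVal_eq_zero_iff (w : List Bool) : binVal w = 0 ↔ ∀ b ∈ w, b = false := by
  induction w with
  | nil => simp [binVal]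
  | cons c w ih => cases c <;> simp [binVal, ih]

/-- Adding the carry `c` to the bit `b` gives the bit `b'` and the carry `c'`. -/
def AddCarry (c b c' b' : Bool) : Prop := c.toNat + b.toNat = b'.toNat + 2 * c'.toNat

theorem AddCarry.exists_add (c b : Bool) : ∃ c' b', AddCarry c b c' b' := by
  cases c <;> cases b <;> simp [AddCarry]

/-- Subtraction is addition read backwards: `b'` is the old bit, `b` the new one, and the carries
are borrows. -/
theorem AddCarry.exists_sub (c b' : Bool) : ∃ c' b, AddCarry c b c' b' := by
  cases c <;> cases b' <;> simp [AddCarry]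

/-! ### The simulating sweeping machine -/

/-- What the `k` heads of an automaton read and how they move in one step. -/
abbrev StepRecord (k : ℕ) (α : Type) : Type := Fin k → InputSymbol α × HeadMove

/-- Contents of a work tape cell: a bit of the counter for the input length, for each head a bit
and a mark which encode its position, and possibly the record of a step. -/
structure Cell (k : ℕ) (α : Type) where
  cnt : Bool
  pos : Fin k → Bool × Bool
  tr : Option (StepRecord k α)

theorem Cell.finite (k : ℕ) (α : Type) [Finite α] : Finite (Cell k α) := by
  have := InputSymbol.finite α
  have := HeadMove.finite
  refine Finite.of_injective
    (fun d : Cell k α => ((d.cnt, d.pos, d.tr) : Bool × (Fin k → Bool × Bool) × Option _)) ?_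
  rintro ⟨_, _, _⟩ ⟨_, _, _⟩ h
  simpa using h

namespace TwoNFA

variable {k : ℕ} {α : Type} (M : TwoNFA k α)

/-- Control states of the simulation. -/
inductive Ctl : Type
  | setup : Ctl
  | rewind : Ctl
  | main : M.Q → Ctl
  | walk : Fin (k + 1) → M.Q → Ctl
  | verify : Fin k → M.Q → Ctl
  | back : Fin k → M.Q → Ctl
  | acc : Ctl

/-- Sweep states of the simulation. -/
inductive Swp : Type
  /-- Increment the counter for the input length. -/
  | count : Bool → Swp
  /-- Change nothing. -/
  | idle : M.Ctl → Swp
  /-- Guess the records of a block of steps. -/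
  | guess : M.Q → Swp
  /-- Decrement the counter of a head while moving the input head right. -/
  | dec : Fin k → Bool → M.Q → Swp
  /-- Move the input head right by the number of marks. -/
  | fin : Fin k → M.Q → Swp
  /-- Verify the records for one head. -/
  | ver : Fin k → M.Q → Swp
  /-- Increment the counter of a head while moving the input head left. -/
  | inc : Fin k → Bool → M.Q → Swp
  /-- Move the input head left by a guessed number of marks. -/
  | finb : Fin k → M.Q → Swp

theorem Ctl.finite : Finite M.Ctl := by
  have := M.finite_Q
  refine Finite.of_injective
    (fun s : M.Ctl => match s with
      | .setup => (Sum.inl 0 : Fin 3 ⊕ M.Q ⊕ (Fin (k + 1) × M.Q) ⊕ Bool × (Fin k × M.Q))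
      | .rewind => Sum.inl 1
      | .acc => Sum.inl 2
      | .main q => Sum.inr (Sum.inl q)
      | .walk i q => Sum.inr (Sum.inr (Sum.inl (i, q)))
      | .verify i q => Sum.inr (Sum.inr (Sum.inr (true, i, q)))
      | .back i q => Sum.inr (Sum.inr (Sum.inr (false, i, q)))) ?_
  intro a b
  cases a <;> cases b <;> simp

theorem Swp.finite : Finite M.Swp := by
  have := M.finite_Q
  have := Ctl.finite M
  refine Finite.of_injective
    (fun s : M.Swp => match s with
      | .count c => (Sum.inl c : Bool ⊕ M.Ctl ⊕ M.Q ⊕ Fin 5 × (Fin k × Bool × M.Q))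
      | .idle p => Sum.inr (Sum.inl p)
      | .guess q => Sum.inr (Sum.inr (Sum.inl q))
      | .dec i c q => Sum.inr (Sum.inr (Sum.inr (0, i, c, q)))
      | .fin i q => Sum.inr (Sum.inr (Sum.inr (1, i, true, q)))
      | .ver i q => Sum.inr (Sum.inr (Sum.inr (2, i, true, q)))
      | .inc i c q => Sum.inr (Sum.inr (Sum.inr (3, i, c, q)))
      | .finb i q => Sum.inr (Sum.inr (Sum.inr (4, i, true, q)))) ?_
  intro a b
  cases a <;> cases b <;> simp

/-- How the sweeps start. -/
inductive SimStart : M.Ctl → InputSymbol α → M.Swp → HeadMove → Prop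
  | count {s} : s ≠ .rightEnd → SimStart .setup s (.count true) .right
  | counted : SimStart .setup .rightEnd (.idle .rewind) .stay
  | rewind {s} : s ≠ .leftEnd → SimStart .rewind s (.idle .rewind) .left
  | rewound : SimStart .rewind .leftEnd (.idle (.main M.q₀)) .stay
  | accept {s} : SimStart (.main M.qacc) s (.idle .acc) .stay
  | guess {s q} : q ≠ M.qacc → SimStart (.main q) s (.guess q) .stay
  | dec {s} (i : Fin k) (q) : SimStart (.walk i.castSucc q) s (.dec i true q) .stay
  | fin {s} (i : Fin k) (q) : SimStart (.walk i.castSucc q) s (.fin i q) .stay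
  | done {s q} : SimStart (.walk (Fin.last k) q) s (.idle (.main q)) .stay
  | ver {s i q} : SimStart (.verify i q) s (.ver i q) .stay
  | inc {s i q} : SimStart (.back i q) s (.inc i true q) .stay
  | finb {s i q} : SimStart (.back i q) s (.finb i q) .stay

/-- How the sweeps process a cell. -/
inductive SimCell : M.Swp → InputSymbol α → Cell k α → M.Swp → Cell k α → HeadMove → Prop
  | count {s d c c' b'} : AddCarry c d.cnt c' b' →
      SimCell (.count c) s d (.count c') ⟨b', d.pos, d.tr⟩ .stay
  | idle {s d p} : SimCell (.idle p) s d (.idle p) d .stay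
  | guess {s d q q'} {f : StepRecord k α} : q ≠ M.qacc → q ≠ M.qrej →
      (q', fun i => (f i).2) ∈ M.δ q (fun i => (f i).1) →
      SimCell (.guess q) s d (.guess q') ⟨d.cnt, d.pos, some f⟩ .stay
  | pad {s d} : SimCell (.guess M.qacc) s d (.guess M.qacc) ⟨d.cnt, d.pos, none⟩ .stay
  | dec {s d i c c' b' q} : s ≠ .rightEnd → AddCarry c b' c' (d.pos i).1 →
      SimCell (.dec i c q) s d (.dec i c' q)
        ⟨d.cnt, Function.update d.pos i (b', (d.pos i).2), d.tr⟩ .right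
  | fin {s d i q} : (d.pos i).1 = false → (d.pos i).2 = false →
      SimCell (.fin i q) s d (.fin i q) d .stay
  | finMark {s d i q} : (d.pos i).1 = false → (d.pos i).2 = true → s ≠ .rightEnd →
      SimCell (.fin i q) s d (.fin i q) d .right
  | ver {d i q} {f : StepRecord k α} : d.tr = some f →
      SimCell (.ver i q) (f i).1 d (.ver i q) d (f i).2
  | verPad {s d i q} : d.tr = none → SimCell (.ver i q) s d (.ver i q) d .stay
  | inc {s d i c c' b' q} : s ≠ .leftEnd → AddCarry c (d.pos i).1 c' b' →
      SimCell (.inc i c q) s d (.inc i c' q)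
        ⟨d.cnt, Function.update d.pos i (b', (d.pos i).2), d.tr⟩ .left
  | finb {s d i q} : SimCell (.finb i q) s d (.finb i q)
        ⟨d.cnt, Function.update d.pos i ((d.pos i).1, false), d.tr⟩ .stay
  | finbMark {s d i q} : s ≠ .leftEnd → SimCell (.finb i q) s d (.finb i q)
        ⟨d.cnt, Function.update d.pos i ((d.pos i).1, true), d.tr⟩ .left

/-- How the sweeps finish. -/
inductive SimFinish : M.Swp → InputSymbol α → M.Ctl → Option (Cell k α) → Prop
  | count {s} : SimFinish (.count false) s .setup none
  | extend {s} : SimFinish (.count true) s .setup (some ⟨true, fun _ => (false, false), none⟩)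
  | idle {s p} : SimFinish (.idle p) s p none
  | guess {s q} : SimFinish (.guess q) s (.walk 0 q) none
  | dec {s i q} : SimFinish (.dec i false q) s (.walk i.castSucc q) none
  | fin {s i q} : SimFinish (.fin i q) s (.verify i q) none
  | ver {s i q} : SimFinish (.ver i q) s (.back i q) none
  | inc {s i q} : SimFinish (.inc i false q) s (.back i q) none
  | finb {i q} : SimFinish (.finb i q) .leftEnd (.walk i.succ q) none

/-- The sweeping machine that simulates `M`. -/
abbrev sim [Finite α] : Sweeper α where
  P := M.Ctl
  finite_P := Ctl.finite M
  A := M.Swp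
  finite_A := Swp.finite M
  D := Cell k α
  finite_D := Cell.finite k α
  start := M.SimStart
  cell := M.SimCell
  finish := M.SimFinish
  p₀ := .setup
  pacc := .acc

/-! ### Head positions encoded in the work word -/

/-- The bits of head `i`. -/
def bits (i : Fin k) (w : List (Cell k α)) : List Bool := w.map fun d => (d.pos i).1

/-- The marks of head `i`. -/
def marks (i : Fin k) (w : List (Cell k α)) : List Bool := w.map fun d => (d.pos i).2

/-- The position of head `i` that the word `w` encodes. -/
def decode (i : Fin k) (w : List (Cell k α)) : ℕ :=
  binVal (bits i w) * w.length + (marks i w).count true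

/-- The step records in the word `w`. -/
def recs (w : List (Cell k α)) : List (Option (StepRecord k α)) := w.map Cell.tr

/-- The word of counter bits. -/
def cnts (w : List (Cell k α)) : List Bool := w.map Cell.cnt

/-- The words agree on the positions of all heads except possibly `i`, and on the records. -/
def SameOff (i : Fin k) (w w' : List (Cell k α)) : Prop :=
  recs w' = recs w ∧ ∀ j, j ≠ i → bits j w' = bits j w ∧ marks j w' = marks j w

theorem SameOff.decode_eq {i j : Fin k} {w w' : List (Cell k α)} (h : SameOff i w w')
    (hj : j ≠ i) : decode j w' = decode j w := by
  have hl := congrArg List.length h.1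
  simp only [recs, List.length_map] at hl
  simp only [decode, (h.2 j hj).1, (h.2 j hj).2, hl]

theorem SameOff.trans {i : Fin k} {w w' w'' : List (Cell k α)} (h : SameOff i w w')
    (h' : SameOff i w' w'') : SameOff i w w'' :=
  ⟨h'.1.trans h.1, fun j hj => ⟨(h'.2 j hj).1.trans (h.2 j hj).1, (h'.2 j hj).2.trans (h.2 j hj).2⟩⟩

theorem SameOff.nil {i : Fin k} : SameOff (α := α) i [] [] := ⟨rfl, fun _ _ => ⟨rfl, rfl⟩⟩

theorem SameOff.cons {i : Fin k} {w w' : List (Cell k α)} (h : SameOff i w w') (d : Cell k α)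
    (v : Bool × Bool) : SameOff i (d :: w) (⟨d.cnt, Function.update d.pos i v, d.tr⟩ :: w') := by
  refine ⟨by simpa [recs] using h.1, fun j hj => ?_⟩
  have := h.2 j hj
  simp only [bits, marks] at this
  simp [bits, marks, Function.update_of_ne hj, this]

/-! ### Computational paths and step records -/

variable {M}

/-- The state runs from `q` to `q'` along the given records. -/
def StateRun (M : TwoNFA k α) : M.Q → List (Option (StepRecord k α)) → M.Q → Prop
  | q, [], q' => q = q'
  | q, none :: l, q' => q = M.qacc ∧ StateRun M q l q'
  | q, some f :: l, q' => q ≠ M.qacc ∧ q ≠ M.qrej ∧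
      ∃ q₁, (q₁, fun i => (f i).2) ∈ M.δ q (fun i => (f i).1) ∧ StateRun M q₁ l q'

/-- Head `i` moves from `p` to `p'` along the given records. -/
def HeadRun (x : List α) (i : Fin k) : ℕ → List (Option (StepRecord k α)) → ℕ → Prop
  | p, [], p' => p = p'
  | p, none :: l, p' => HeadRun x i p l p'
  | p, some f :: l, p' => (f i).1 = inputCell x p ∧ HeadRun x i ((f i).2.onInput x.length p) l p'

theorem HeadRun.le {x : List α} {i : Fin k} {p p' : ℕ} {l : List (Option (StepRecord k α))}
    (h : HeadRun x i p l p') (hp : p ≤ x.length + 1) : p' ≤ x.length + 1 := by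
  induction l generalizing p with
  | nil => exact h ▸ hp
  | cons o l ih =>
    cases o with
    | none => exact ih h hp
    | some f => exact ih h.2 (HeadMove.onInput_le _ hp)

/-- Records that fit the states and all heads describe a computational path. -/
theorem reaches_of_runs {x : List α} {q q' : M.Q} {P P' : Fin k → ℕ}
    {l : List (Option (StepRecord k α))} (hq : StateRun M q l q')
    (hP : ∀ i, HeadRun x i (P i) l (P' i)) :
    ∃ t, ReachesIn (M.Step x) t ⟨q, P⟩ ⟨q', P'⟩ ∧ (q' ≠ M.qacc → t = l.length) := by
  induction l generalizing q P with
  | nil =>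
    obtain rfl : q = q' := hq
    obtain rfl : P = P' := funext hP
    exact ⟨0, .refl _, fun _ => rfl⟩
  | cons o l ih =>
    cases o with
    | none =>
      obtain ⟨rfl, hq⟩ := hq
      obtain ⟨t, ht, h⟩ := ih hq hP
      -- A padding entry forces the accept state, which no step leaves, so the path is trivial and
      -- ends in the accept state.
      refine ⟨t, ht, fun hne => absurd ?_ hne⟩
      by_contra hne
      obtain rfl | ht0 := Nat.eq_zero_or_pos t
      · cases ht; exact hne rfl
      · obtain ⟨s, rfl⟩ := Nat.exists_eq_add_of_le ht0
        obtain ⟨d, h₁, -⟩ := ht.split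
        cases h₁ with
        | tail h hs => cases h; exact hs.1 rfl
    | some f =>
      obtain ⟨h₁, h₂, q₁, hδ, hq⟩ := hq
      obtain ⟨t, ht, h⟩ := ih hq (fun i => (hP i).2)
      refine ⟨1 + t, (ReachesIn.single ?_).trans ht, fun hne => by simp [h hne, add_comm]⟩
      refine ⟨h₁, h₂, _, ?_, rfl⟩
      have : (fun i => inputCell x (P i)) = fun i => (f i).1 := funext fun i => (hP i).1.symm
      simpa only [this] using hδ

theorem stateRun_replicate_none (n : ℕ) : StateRun M M.qacc (List.replicate n none) M.qacc := by
  induction n with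
  | zero => rfl
  | succ n ih => exact ⟨rfl, ih⟩

theorem headRun_replicate_none (x : List α) (i : Fin k) (p n : ℕ) :
    HeadRun x i p (List.replicate n none) p := by
  induction n with
  | zero => rfl
  | succ n ih => exact ih

/-- A computational path of `t` steps has records of length `t`, and of any length `n ≥ t` if it
accepts. -/
theorem runs_of_reaches {x : List α} {t n : ℕ} {c d : M.Cfg} (h : ReachesIn (M.Step x) t c d)
    (htn : t = n ∨ t ≤ n ∧ d.state = M.qacc) :
    ∃ l : List (Option (StepRecord k α)), l.length = n ∧ StateRun M c.state l d.state ∧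
      ∀ i, HeadRun x i (c.pos i) l (d.pos i) := by
  induction t generalizing c n with
  | zero =>
    cases h
    refine ⟨List.replicate n none, by simp, ?_, fun i => headRun_replicate_none _ _ _ _⟩
    rcases htn with rfl | ⟨-, h⟩
    · rfl
    · rw [h]; exact stateRun_replicate_none n
  | succ t ih =>
    -- The first step is split off, not the last, since records are read from the front.
    rw [add_comm] at h
    obtain ⟨e, h₁, h₂⟩ := h.split
    cases h₁ with
    | tail h₁ hs =>
      cases h₁
      obtain ⟨n, rfl⟩ : ∃ n', n = n' + 1 := ⟨n - 1, by omega⟩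
      obtain ⟨l, hl, hq, hP⟩ := ih (n := n) h₂
        (htn.imp (fun h => by omega) fun h => ⟨by omega, h.2⟩)
      obtain ⟨ha, hr, m, hδ, hpos⟩ := hs
      refine ⟨some (fun i => (inputCell x (c.pos i), m i)) :: l, by simp [hl], ⟨ha, hr, _, hδ, hq⟩,
        fun i => ⟨rfl, ?_⟩⟩
      have := hP i
      rwa [hpos] at this

theorem pos_le_of_reaches {x : List α} {t : ℕ} {c : M.Cfg} (h : ReachesIn (M.Step x) t M.init c)
    (i : Fin k) : c.pos i ≤ x.length + 1 := by
  generalize hc₀ : M.init = c₀ at h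
  induction h with
  | refl => subst hc₀; exact Nat.zero_le _
  | tail _ hs ih =>
    obtain ⟨-, -, m, -, hpos⟩ := hs
    rw [hpos]
    exact HeadMove.onInput_le _ (ih hc₀)

end TwoNFA

namespace TwoNFA

variable {k : ℕ} {α : Type} {M : TwoNFA k α} [Finite α] {x : List α}

/-! ### The effect of the sweeps -/

/-- Ripple-carry addition, least significant bit first. The outgoing carry has weight `2 ^ w.length`
and tells the finish whether to append a cell. -/
theorem sweep_count {c : Bool} {p p' : ℕ} {w w' : List (Cell k α)} {a' : M.Swp}
    (h : M.sim.Sweep x (.count c) p w a' p' w') :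
    ∃ c', a' = .count c' ∧ p' = p ∧ w'.map Cell.pos = w.map Cell.pos ∧
      c.toNat + binVal (cnts w) = binVal (cnts w') + 2 ^ w.length * c'.toNat := by
  induction w generalizing c w' with
  | nil => obtain ⟨rfl, rfl, rfl⟩ := h.of_nil; exact ⟨c, rfl, rfl, rfl, by simp [cnts, binVal]⟩
  | cons d w ih =>
    obtain ⟨a₁, d', mv, w', hc, hs, rfl⟩ := h.of_cons
    cases hc with
    | count hadd =>
      obtain ⟨c', rfl, rfl, h₁, h₂⟩ := ih hs
      refine ⟨c', rfl, rfl, by simp [h₁], ?_⟩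
      simp only [AddCarry] at hadd
      simp only [cnts] at h₂
      simp only [cnts, List.map_cons, binVal, List.length_cons, pow_succ]
      linear_combination hadd + 2 * h₂

theorem exists_sweep_count (c : Bool) (p : ℕ) (w : List (Cell k α)) :
    ∃ c' w', M.sim.Sweep x (.count c) p w (.count c') p w' := by
  induction w generalizing c with
  | nil => exact ⟨c, [], .nil _ _⟩
  | cons d w ih =>
    obtain ⟨c₁, b, h⟩ := AddCarry.exists_add c d.cnt
    obtain ⟨c', w', hs⟩ := ih c₁
    exact ⟨c', _, .cons (SimCell.count h) hs⟩

theorem sweep_idle {r : M.Ctl} {p p' : ℕ} {w w' : List (Cell k α)} {a' : M.Swp}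
    (h : M.sim.Sweep x (.idle r) p w a' p' w') : a' = .idle r ∧ p' = p ∧ w' = w := by
  induction w generalizing w' with
  | nil => obtain ⟨rfl, rfl, rfl⟩ := h.of_nil; exact ⟨rfl, rfl, rfl⟩
  | cons d w ih =>
    obtain ⟨a₁, d', mv, w', hc, hs, rfl⟩ := h.of_cons
    cases hc
    obtain ⟨h₁, h₂, rfl⟩ := ih hs
    exact ⟨h₁, h₂, rfl⟩

theorem exists_sweep_idle (r : M.Ctl) (p : ℕ) (w : List (Cell k α)) :
    M.sim.Sweep x (.idle r) p w (.idle r) p w := by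
  induction w with
  | nil => exact .nil _ _
  | cons d w ih => exact .cons SimCell.idle ih

theorem sweep_guess {q : M.Q} {p p' : ℕ} {w w' : List (Cell k α)} {a' : M.Swp}
    (h : M.sim.Sweep x (.guess q) p w a' p' w') :
    ∃ q', a' = .guess q' ∧ p' = p ∧ w'.map Cell.pos = w.map Cell.pos ∧
      StateRun M q (recs w') q' := by
  induction w generalizing q w' with
  | nil => obtain ⟨rfl, rfl, rfl⟩ := h.of_nil; exact ⟨q, rfl, rfl, rfl, rfl⟩
  | cons d w ih =>
    obtain ⟨a₁, d', mv, w', hc, hs, rfl⟩ := h.of_cons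
    cases hc with
    | guess ha hr hδ =>
      obtain ⟨q', rfl, rfl, h₁, h₂⟩ := ih hs
      exact ⟨q', rfl, rfl, by simp [h₁], ha, hr, _, hδ, h₂⟩
    | pad =>
      obtain ⟨q', rfl, rfl, h₁, h₂⟩ := ih hs
      exact ⟨q', rfl, rfl, by simp [h₁], rfl, h₂⟩

theorem exists_sweep_guess {q q' : M.Q} (p : ℕ) {w : List (Cell k α)}
    {l : List (Option (StepRecord k α))} (h : StateRun M q l q') (hl : l.length = w.length) :
    ∃ w', M.sim.Sweep x (.guess q) p w (.guess q') p w' ∧ recs w' = l := by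
  induction w generalizing q l with
  | nil =>
    obtain rfl := List.length_eq_zero_iff.1 hl
    obtain rfl : q = q' := h
    exact ⟨[], .nil _ _, rfl⟩
  | cons d w ih =>
    cases l with
    | nil => simp at hl
    | cons o l =>
      have hl' : l.length = w.length := by simpa using hl
      cases o with
      | none =>
        obtain ⟨rfl, h⟩ := h
        obtain ⟨w', hs, hr⟩ := ih h hl'
        exact ⟨_, .cons SimCell.pad hs, by simpa [recs] using hr⟩
      | some f =>
        obtain ⟨ha, hr, q₁, hδ, h⟩ := h
        obtain ⟨w', hs, hr'⟩ := ih h hl'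
        exact ⟨_, .cons (SimCell.guess ha hr hδ) hs, by simpa [recs] using hr'⟩

/-- Decrementing is `AddCarry` with old and new bits exchanged. Each cell demands that the input
head is not on the right marker, so every move is effective and the displacement is exactly
`w.length`. -/
theorem sweep_dec {i : Fin k} {c : Bool} {q : M.Q} {p p' : ℕ} {w w' : List (Cell k α)}
    {a' : M.Swp} (h : M.sim.Sweep x (.dec i c q) p w a' p' w') (hp : p ≤ x.length + 1) :
    ∃ c', a' = .dec i c' q ∧ p' = p + w.length ∧ p' ≤ x.length + 1 ∧ SameOff i w w' ∧
      marks i w' = marks i w ∧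
      c.toNat + binVal (bits i w') = binVal (bits i w) + 2 ^ w.length * c'.toNat := by
  induction w generalizing c p w' with
  | nil => obtain ⟨rfl, rfl, rfl⟩ := h.of_nil; exact ⟨c, rfl, rfl, hp, .nil, rfl, by simp [bits, binVal]⟩
  | cons d w ih =>
    obtain ⟨a₁, d', mv, w', hc, hs, rfl⟩ := h.of_cons
    cases hc with
    | dec hne hadd =>
      obtain ⟨e, he⟩ := HeadMove.right_onInput hne
      rw [e] at hs
      obtain ⟨c', rfl, rfl, h₁, h₂, h₃, h₄⟩ := ih hs he
      refine ⟨c', rfl, by simp; omega, h₁, h₂.cons d _, ?_, ?_⟩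
      · simpa [marks] using h₃
      · simp only [AddCarry] at hadd
        simp only [bits] at h₄
        simp only [bits, List.map_cons, Function.update_self, binVal, List.length_cons, pow_succ]
        linear_combination hadd + 2 * h₄

theorem exists_sweep_dec (i : Fin k) (c : Bool) (q : M.Q) {p : ℕ} {w : List (Cell k α)}
    (hp : p + w.length ≤ x.length + 1) :
    ∃ c' p' w', M.sim.Sweep x (.dec i c q) p w (.dec i c' q) p' w' := by
  induction w generalizing c p with
  | nil => exact ⟨c, p, [], .nil _ _⟩
  | cons d w ih =>
    simp only [List.length_cons] at hp
    have hne : inputCell x p ≠ .rightEnd := by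
      rw [ne_eq, inputCell_eq_rightEnd_iff]; omega
    obtain ⟨c₁, b, h⟩ := AddCarry.exists_sub c (d.pos i).1
    obtain ⟨c', p', w', hs⟩ := ih c₁ (p := p + 1) (by omega)
    rw [← (HeadMove.right_onInput hne).1] at hs
    exact ⟨c', p', _, .cons (SimCell.dec hne h) hs⟩

/-- Every bit is tested to be zero, so a path that stops decrementing too early dies here. -/
theorem sweep_fin {i : Fin k} {q : M.Q} {p p' : ℕ} {w w' : List (Cell k α)}
    {a' : M.Swp} (h : M.sim.Sweep x (.fin i q) p w a' p' w') :
    a' = .fin i q ∧ w' = w ∧ p' = p + (marks i w).count true ∧ binVal (bits i w) = 0 := by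
  induction w generalizing p w' with
  | nil => obtain ⟨rfl, rfl, rfl⟩ := h.of_nil; exact ⟨rfl, rfl, rfl, rfl⟩
  | cons d w ih =>
    obtain ⟨a₁, d', mv, w', hc, hs, rfl⟩ := h.of_cons
    cases hc with
    | fin hb hm =>
      obtain ⟨rfl, rfl, rfl, hz⟩ := ih hs
      simp only [bits] at hz
      simp [bits, marks, binVal, hb, hm, hz, HeadMove.onInput]
    | finMark hb hm hne =>
      rw [(HeadMove.right_onInput hne).1] at hs
      obtain ⟨rfl, rfl, rfl, hz⟩ := ih hs
      simp only [bits] at hz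
      simp [bits, marks, binVal, hb, hm, hz]; omega

theorem exists_sweep_fin (i : Fin k) (q : M.Q) {p : ℕ} {w : List (Cell k α)}
    (hw : binVal (bits i w) = 0) (hp : p + (marks i w).count true ≤ x.length + 1) :
    ∃ p', M.sim.Sweep x (.fin i q) p w (.fin i q) p' w := by
  induction w generalizing p with
  | nil => exact ⟨p, .nil _ _⟩
  | cons d w ih =>
    simp only [bits, List.map_cons, binVal] at hw
    have hb : (d.pos i).1 = false := by
      cases h : (d.pos i).1
      · rfl
      · simp [h] at hw
    have hw' : binVal (bits i w) = 0 := by simp only [bits]; omega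
    cases hm : (d.pos i).2 with
    | false =>
      obtain ⟨p', hs⟩ := ih (p := p) hw' (by simpa [marks, hm] using hp)
      exact ⟨p', .cons (SimCell.fin hb hm) hs⟩
    | true =>
      simp only [marks, List.map_cons, hm, List.count_cons_self] at hp
      have hne : inputCell x p ≠ .rightEnd := by
        rw [ne_eq, inputCell_eq_rightEnd_iff]; omega
      obtain ⟨p', hs⟩ := ih (p := p + 1) hw' (by simp only [marks]; omega)
      rw [← (HeadMove.right_onInput hne).1] at hs
      exact ⟨p', .cons (SimCell.finMark hb hm hne) hs⟩

theorem sweep_ver {i : Fin k} {q : M.Q} {p p' : ℕ} {w w' : List (Cell k α)}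
    {a' : M.Swp} (h : M.sim.Sweep x (.ver i q) p w a' p' w') :
    a' = .ver i q ∧ w' = w ∧ HeadRun x i p (recs w) p' := by
  induction w generalizing p w' with
  | nil => obtain ⟨rfl, rfl, rfl⟩ := h.of_nil; exact ⟨rfl, rfl, rfl⟩
  | cons d w ih =>
    obtain ⟨a₁, d', mv, w', hc, hs, rfl⟩ := h.of_cons
    generalize hsym : inputCell x p = s at hc
    cases hc with
    | ver hd =>
      obtain ⟨rfl, rfl, h⟩ := ih hs
      refine ⟨rfl, rfl, ?_⟩
      simp only [recs, List.map_cons, hd]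
      exact ⟨hsym.symm, h⟩
    | verPad hd =>
      obtain ⟨rfl, rfl, h⟩ := ih hs
      refine ⟨rfl, rfl, ?_⟩
      simp only [recs, List.map_cons, hd]
      exact h

theorem exists_sweep_ver {i : Fin k} (q : M.Q) {p p' : ℕ} {w : List (Cell k α)}
    (h : HeadRun x i p (recs w) p') : M.sim.Sweep x (.ver i q) p w (.ver i q) p' w := by
  induction w generalizing p with
  | nil => obtain rfl : p = p' := h; exact .nil _ _
  | cons d w ih =>
    simp only [recs, List.map_cons] at h
    cases hd : d.tr with
    | none =>
      rw [hd] at h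
      exact .cons (SimCell.verPad hd) (ih h)
    | some f =>
      rw [hd] at h
      exact .cons (h.1 ▸ SimCell.ver hd) (ih h.2)

/-- Mirror image of `sweep_dec`. The marks need no control here, as the sweep of `sweep_finb`
overwrites them all. -/
theorem sweep_inc {i : Fin k} {c : Bool} {q : M.Q} {p p' : ℕ} {w w' : List (Cell k α)}
    {a' : M.Swp} (h : M.sim.Sweep x (.inc i c q) p w a' p' w') :
    ∃ c', a' = .inc i c' q ∧ p' + w.length = p ∧ SameOff i w w' ∧
      c.toNat + binVal (bits i w) = binVal (bits i w') + 2 ^ w.length * c'.toNat := by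
  induction w generalizing c p w' with
  | nil => obtain ⟨rfl, rfl, rfl⟩ := h.of_nil; exact ⟨c, rfl, rfl, .nil, by simp [bits, binVal]⟩
  | cons d w ih =>
    obtain ⟨a₁, d', mv, w', hc, hs, rfl⟩ := h.of_cons
    cases hc with
    | inc hne hadd =>
      have e := HeadMove.left_onInput hne
      obtain ⟨c', rfl, h₁, h₂, h₄⟩ := ih hs
      refine ⟨c', rfl, by simp; omega, h₂.cons d _, ?_⟩
      simp only [AddCarry] at hadd
      simp only [bits] at h₄
      simp only [bits, List.map_cons, Function.update_self, binVal, List.length_cons, pow_succ]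
      linear_combination hadd + 2 * h₄

theorem exists_sweep_inc (i : Fin k) (c : Bool) (q : M.Q) {p : ℕ} {w : List (Cell k α)}
    (hp : w.length ≤ p) :
    ∃ c' p' w', M.sim.Sweep x (.inc i c q) p w (.inc i c' q) p' w' := by
  induction w generalizing c p with
  | nil => exact ⟨c, p, [], .nil _ _⟩
  | cons d w ih =>
    simp only [List.length_cons] at hp
    have hne : inputCell x p ≠ .leftEnd := by
      rw [ne_eq, inputCell_eq_leftEnd_iff]; omega
    obtain ⟨c₁, b, h⟩ := AddCarry.exists_add c (d.pos i).1
    have e := HeadMove.left_onInput hne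
    obtain ⟨c', p', w', hs⟩ := ih c₁ (p := HeadMove.left.onInput x.length p) (by omega)
    exact ⟨c', p', _, .cons (SimCell.inc hne h) hs⟩

/-- Each new mark is matched by one effective move to the left. Since the sweep may finish only on
the left marker, the guessed marks then count the remaining distance exactly. -/
theorem sweep_finb {i : Fin k} {q : M.Q} {p p' : ℕ} {w w' : List (Cell k α)}
    {a' : M.Swp} (h : M.sim.Sweep x (.finb i q) p w a' p' w') :
    a' = .finb i q ∧ p' + (marks i w').count true = p ∧ SameOff i w w' ∧
      bits i w' = bits i w := by
  induction w generalizing p w' with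
  | nil => obtain ⟨rfl, rfl, rfl⟩ := h.of_nil; exact ⟨rfl, rfl, .nil, rfl⟩
  | cons d w ih =>
    obtain ⟨a₁, d', mv, w', hc, hs, rfl⟩ := h.of_cons
    cases hc with
    | finb =>
      obtain ⟨rfl, h₁, h₂, h₃⟩ := ih hs
      simp only [bits, marks] at h₁ h₃
      exact ⟨rfl, by simpa [marks, HeadMove.onInput] using h₁, h₂.cons d _, by simp [bits, h₃]⟩
    | finbMark hne =>
      have e := HeadMove.left_onInput hne
      obtain ⟨rfl, h₁, h₂, h₃⟩ := ih hs
      simp only [bits, marks] at h₁ h₃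
      exact ⟨rfl, by simp [marks]; omega, h₂.cons d _, by simp [bits, h₃]⟩

theorem exists_sweep_finb (i : Fin k) (q : M.Q) {p : ℕ} {w : List (Cell k α)}
    (hp : p ≤ w.length) : ∃ w', M.sim.Sweep x (.finb i q) p w (.finb i q) 0 w' := by
  induction w generalizing p with
  | nil => obtain rfl := Nat.le_zero.1 hp; exact ⟨[], .nil _ _⟩
  | cons d w ih =>
    rcases Nat.eq_zero_or_pos p with rfl | h₀
    · obtain ⟨w', hs⟩ := ih (p := 0) (Nat.zero_le _)
      exact ⟨_, .cons SimCell.finb hs⟩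
    · have hne : inputCell x p ≠ .leftEnd := by
        rw [ne_eq, inputCell_eq_leftEnd_iff]; omega
      have e := HeadMove.left_onInput hne
      simp only [List.length_cons] at hp
      obtain ⟨w', hs⟩ := ih (p := HeadMove.left.onInput x.length p) (by omega)
      exact ⟨_, .cons (SimCell.finbMark hne) hs⟩

end TwoNFA

/-! ### The invariant of the simulation and the number of sweeps -/

namespace TwoNFA

variable {k : ℕ} {α : Type} {M : TwoNFA k α} {x : List α}

theorem bits_eq_of_map_pos_eq {w w' : List (Cell k α)} (h : w'.map Cell.pos = w.map Cell.pos)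
    (j : Fin k) : bits j w' = bits j w := by
  have := congrArg (List.map fun f => (f j).1) h
  rwa [List.map_map, List.map_map] at this

theorem marks_eq_of_map_pos_eq {w w' : List (Cell k α)} (h : w'.map Cell.pos = w.map Cell.pos)
    (j : Fin k) : marks j w' = marks j w := by
  have := congrArg (List.map fun f => (f j).2) h
  rwa [List.map_map, List.map_map] at this

theorem decode_eq_of_map_pos_eq {w w' : List (Cell k α)} (h : w'.map Cell.pos = w.map Cell.pos)
    (j : Fin k) : decode j w' = decode j w := by
  have hl : w'.length = w.length := by simpa using congrArg List.length h
  rw [decode, decode, bits_eq_of_map_pos_eq h, marks_eq_of_map_pos_eq h, hl]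

/-- All heads are recorded at position `0`. -/
def Fresh (w : List (Cell k α)) : Prop := ∀ f ∈ w.map Cell.pos, f = fun _ => (false, false)

theorem Fresh.decode_eq_zero {w : List (Cell k α)} (h : Fresh w) (j : Fin k) : decode j w = 0 := by
  simp only [Fresh, List.mem_map, forall_exists_index, and_imp, forall_apply_eq_imp_iff₂] at h
  have h₁ : binVal (bits j w) = 0 := by
    rw [binVal_eq_zero_iff]
    simp only [bits, List.mem_map, forall_exists_index, and_imp, forall_apply_eq_imp_iff₂]
    intro d hd
    rw [h d hd]
  have h₂ : (marks j w).count true = 0 := by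
    rw [List.count_eq_zero]
    simp only [marks, List.mem_map, not_exists, not_and]
    intro d hd
    rw [h d hd]
    simp
  rw [decode, h₁, h₂, zero_mul]

/-- The length of the blocks for inputs of length `n`. -/
def blockLen (n : ℕ) : ℕ := (n + 1).size

theorem blockLen_pos (n : ℕ) : 0 < blockLen n := Nat.size_pos.2 n.succ_pos

/-- A bound for the number of sweeps spent on one head in one block. -/
def headCost (n : ℕ) : ℕ := 2 * ((n + 1) / blockLen n) + 3

/-- A bound for the number of sweeps spent on one block. -/
def blockCost (k n : ℕ) : ℕ := k * headCost n + 2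

/-- A bound for the number of sweeps spent before block `B`. -/
def costBefore (k n B : ℕ) : ℕ := 2 * n + 4 + B * blockCost k n

theorem costBefore_succ (k n B : ℕ) :
    costBefore k n (B + 1) = costBefore k n B + k * headCost n + 2 := by
  simp only [costBefore, blockCost]; ring

variable (M x) in
/-- After `B` blocks, `M` is in configuration `c`, the records in `w` lead to state `q`, and the
heads before head `i` have been processed. -/
structure InBlock (q : M.Q) (w : List (Cell k α)) (i : ℕ) (c : M.Cfg) (t B : ℕ) : Prop where
  length_eq : w.length = blockLen x.length
  reach : ReachesIn (M.Step x) t M.init c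
  full : B * blockLen x.length ≤ t
  run : StateRun M c.state (recs w) q
  done : ∀ j : Fin k, (j : ℕ) < i → HeadRun x j (c.pos j) (recs w) (decode j w)
  todo : ∀ j : Fin k, i < (j : ℕ) → decode j w = c.pos j

/-- The head `i` in progress is covered by neither `done` nor `todo`, so its bits and marks may
change freely. -/
theorem InBlock.congr {q : M.Q} {w w' : List (Cell k α)} {i : Fin k} {c : M.Cfg} {t B : ℕ}
    (h : InBlock M x q w i c t B) (hw : SameOff i w w') : InBlock M x q w' i c t B where
  length_eq := by
    rw [← h.length_eq]
    simpa [recs] using congrArg List.length hw.1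
  reach := h.reach
  full := h.full
  run := hw.1 ▸ h.run
  done j hj := by
    rw [hw.1, hw.decode_eq (Fin.ne_of_lt hj)]
    exact h.done j hj
  todo j hj := by
    rw [hw.decode_eq (Fin.ne_of_gt hj)]
    exact h.todo j hj

variable (M x) in
/-- The invariant of the simulation after `m` sweeps. -/
def SimInv (m : ℕ) : M.Ctl → ℕ → List (Cell k α) → Prop
  | .setup, p, w => Fresh w ∧ w.length = p.size ∧ binVal (cnts w) = p ∧ p ≤ x.length + 1 ∧ m = p
  | .rewind, p, w => Fresh w ∧ w.length = blockLen x.length ∧ m + p ≤ 2 * x.length + 3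
  | .main q, p, w => p = 0 ∧ w.length = blockLen x.length ∧ ∃ t B P,
      ReachesIn (M.Step x) t M.init ⟨q, P⟩ ∧ (∀ j, decode j w = P j) ∧
      B * blockLen x.length ≤ t + blockLen x.length ∧
      (q ≠ M.qacc → B * blockLen x.length ≤ t) ∧ m ≤ costBefore k x.length B
  | .walk i q, p, w => ∃ c t B a, InBlock M x q w i c t B ∧
      (∀ j : Fin k, (j : ℕ) = i → p + decode j w = c.pos j) ∧ ((i : ℕ) = k → p = 0) ∧
      a * blockLen x.length = p ∧ p ≤ x.length + 1 ∧
      m ≤ costBefore k x.length B + 1 + i * headCost x.length + a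
  | .verify i q, p, w => ∃ c t B, InBlock M x q w i c t B ∧ p = c.pos i ∧
      binVal (bits i w) = 0 ∧ m ≤ costBefore k x.length B + 1 + i * headCost x.length +
        ((x.length + 1) / blockLen x.length + 1)
  | .back i q, p, w => ∃ c t B a, InBlock M x q w i c t B ∧
      HeadRun x i (c.pos i) (recs w) (binVal (bits i w) * blockLen x.length + p) ∧
      a * blockLen x.length + p ≤ x.length + 1 ∧
      m ≤ costBefore k x.length B + 1 + i * headCost x.length +
        ((x.length + 1) / blockLen x.length + 2 + a)
  | .acc, _, w => w.length = blockLen x.length ∧ ∃ t B c,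
      ReachesIn (M.Step x) t M.init c ∧ c.state = M.qacc ∧
      B * blockLen x.length ≤ t + blockLen x.length ∧ m ≤ costBefore k x.length B + 1

theorem SimInv.init : SimInv M x 0 .setup 0 [] := by
  simp [SimInv, Fresh, cnts, binVal]

/-- The `B` verified blocks stand for a real path, so `T` bounds their number whatever has been
guessed since. Inside a block, the counter `a` of walking sweeps is at most `(n + 1) / blockLen n`,
as each of them crosses `blockLen n` input cells. -/
theorem SimInv.bounds {m p T : ℕ} {r : M.Ctl} {w : List (Cell k α)} (h : SimInv M x m r p w)
    (hT : ∀ t c, ReachesIn (M.Step x) t M.init c → t ≤ T) :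
    w.length ≤ blockLen x.length ∧
      m ≤ costBefore k x.length (T / blockLen x.length + 1) + 1 := by
  have hpos := blockLen_pos x.length
  have mono : ∀ {B B'}, B ≤ B' → costBefore k x.length B ≤ costBefore k x.length B' := fun h => by
    have := Nat.mul_le_mul_right (blockCost k x.length) h
    simp only [costBefore]; omega
  have head : ∀ i : Fin k, (i : ℕ) * headCost x.length + headCost x.length
      ≤ k * headCost x.length := fun i => by
    rw [← Nat.succ_mul]; exact Nat.mul_le_mul_right _ i.isLt
  -- The two walks contribute the quotient twice; the `3` covers the final partial walk to the
  -- position, the verification, and the final partial walk back.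
  have hcost : headCost x.length = 2 * ((x.length + 1) / blockLen x.length) + 3 := rfl
  have blocks : ∀ {B t}, B * blockLen x.length ≤ t → t ≤ T →
      costBefore k x.length (B + 1) ≤ costBefore k x.length (T / blockLen x.length + 1) :=
    fun {B t} h₁ h₂ => mono (Nat.succ_le_succ ((Nat.le_div_iff_mul_le hpos).2 (h₁.trans h₂)))
  have base : 2 * x.length + 6 ≤ costBefore k x.length (T / blockLen x.length + 1) := by
    refine le_trans ?_ (mono (Nat.le_add_left 1 _))
    simp only [costBefore, blockCost]; omega
  -- An accepting block may contain fewer than `blockLen` real steps, which costs at most one extra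
  -- block.
  have last : ∀ {B t}, B * blockLen x.length ≤ t + blockLen x.length → t ≤ T →
      B ≤ T / blockLen x.length + 1 := fun h₁ h₂ => by
    rw [← Nat.add_div_right _ hpos, Nat.le_div_iff_mul_le hpos]
    omega
  cases r with
  | setup =>
    obtain ⟨-, hl, -, hle, rfl⟩ := h
    exact ⟨hl ▸ Nat.size_le_size hle, by omega⟩
  | rewind =>
    obtain ⟨-, hl, hm⟩ := h
    exact ⟨hl.le, by omega⟩
  | main q =>
    obtain ⟨-, hl, t, B, P, hr, -, hB, -, hm⟩ := h
    exact ⟨hl.le, (hm.trans (mono (last hB (hT _ _ hr)))).trans (Nat.le_succ _)⟩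
  | walk i q =>
    obtain ⟨c, t, B, a, hb, -, hk, ha, hle, hm⟩ := h
    refine ⟨hb.length_eq.le, le_trans ?_
      ((blocks hb.full (hT _ _ hb.reach)).trans (Nat.le_succ _))⟩
    rw [costBefore_succ]
    rcases Fin.eq_castSucc_or_eq_last i with ⟨j, rfl⟩ | rfl
    · have ha' : a ≤ (x.length + 1) / blockLen x.length := by
        rw [Nat.le_div_iff_mul_le hpos]; omega
      have := head j
      simp only [Fin.val_castSucc] at hm
      omega
    · obtain rfl := hk rfl
      have ha0 : a = 0 := by simpa [hpos.ne'] using ha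
      simp only [Fin.val_last] at hm
      omega
  | verify i q =>
    obtain ⟨c, t, B, hb, -, -, hm⟩ := h
    refine ⟨hb.length_eq.le, le_trans ?_
      ((blocks hb.full (hT _ _ hb.reach)).trans (Nat.le_succ _))⟩
    rw [costBefore_succ]
    have := head i
    omega
  | back i q =>
    obtain ⟨c, t, B, a, hb, -, ha, hm⟩ := h
    refine ⟨hb.length_eq.le, le_trans ?_
      ((blocks hb.full (hT _ _ hb.reach)).trans (Nat.le_succ _))⟩
    rw [costBefore_succ]
    have := head i
    have ha' : a ≤ (x.length + 1) / blockLen x.length := by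
      rw [Nat.le_div_iff_mul_le hpos]; omega
    omega
  | acc =>
    obtain ⟨hl, t, B, c, hr, -, hB, hm⟩ := h
    exact ⟨hl.le, hm.trans (Nat.succ_le_succ (mono (last hB (hT _ _ hr))))⟩

variable [Finite α]

/-- On the way out, input position plus encoded position stays the true position of the head; on the
way back, the same holds for counter times block length plus input position. A sweep trades
`blockLen` cells of one summand for the other. -/
theorem SimInv.step {m : ℕ} {c d : M.sim.Cfg} (h : SimInv M x m c.state c.inPos c.word)
    (hs : M.sim.Step x c d) : SimInv M x (m + 1) d.state d.inPos d.word := by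
  obtain ⟨r, p, w⟩ := c
  obtain ⟨r', p', w''⟩ := d
  obtain ⟨-, a, mv, a', w', o, hst, hsw, hf, hw⟩ := hs
  simp only at h hst hsw hf hw ⊢
  subst hw
  generalize hsym : inputCell x p = s at hst
  generalize hsym' : inputCell x p' = s' at hf
  have hpos := blockLen_pos x.length
  have hlen := hsw.length_eq
  cases hst with
  | count hne =>
    subst hsym
    obtain ⟨hF, hl, hv, -, hm⟩ := h
    obtain ⟨e, he⟩ := HeadMove.right_onInput hne
    obtain ⟨c', rfl, rfl, h₁, h₂⟩ := sweep_count hsw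
    have hlt := binVal_lt (cnts w)
    have hcl : (cnts w).length = w.length := by simp [cnts]
    have hcl' : (cnts w').length = w.length := by simp [cnts, hlen]
    rw [hcl] at hlt
    have hF' : Fresh w' := by simpa only [Fresh, h₁] using hF
    simp only [Bool.toNat_true] at h₂
    cases hf with
    | count =>
      have hlt' := binVal_lt (cnts w')
      simp only [Bool.toNat_false, mul_zero, add_zero] at h₂
      rw [hcl'] at hlt'
      refine ⟨by simpa using hF', ?_, by simp; omega, by omega, by omega⟩
      rw [e]
      simp only [Option.toList_none, List.append_nil, hlen]
      -- Without an outgoing carry, `p + 1` still fits into `w.length` bits, so its size is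
      -- unchanged.
      refine le_antisymm (hl.trans_le (Nat.size_le_size (Nat.le_succ p))) ?_
      rw [Nat.size_le]
      omega
    | extend =>
      simp only [Bool.toNat_true, mul_one] at h₂
      -- Overflow occurs exactly at a power of two, where the binary length grows by one, as does
      -- the word.
      have hp1 : p + 1 = 2 ^ w.length := by omega
      refine ⟨?_, ?_, ?_, by omega, by omega⟩
      · simp only [Fresh, Option.toList_some, List.map_append, List.mem_append]
        rintro f (hf | hf)
        · exact hF' f hf
        · simpa using hf
      · rw [e, hp1, Nat.size_pow]
        simp [hlen]
      · rw [e, Option.toList_some, cnts, List.map_append, List.map_singleton,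
          binVal_append_singleton]
        change binVal (cnts w') + 2 ^ (cnts w').length * 1 = p + 1
        rw [hcl']
        omega
  | counted =>
    obtain ⟨rfl, rfl, rfl⟩ := sweep_idle hsw
    obtain ⟨hF, hl, hv, hle, hm⟩ := h
    rw [inputCell_eq_rightEnd_iff] at hsym
    obtain rfl : p' = x.length + 1 := by omega
    cases hf
    simp only [Option.toList_none, List.append_nil]
    exact ⟨hF, hl, by omega⟩
  | rewind hne =>
    subst hsym
    have e := HeadMove.left_onInput hne
    obtain ⟨rfl, rfl, rfl⟩ := sweep_idle hsw
    obtain ⟨hF, hl, hm⟩ := h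
    cases hf
    exact ⟨by simpa using hF, by simpa using hl, by omega⟩
  | rewound =>
    obtain ⟨rfl, rfl, rfl⟩ := sweep_idle hsw
    obtain ⟨hF, hl, hm⟩ := h
    rw [inputCell_eq_leftEnd_iff] at hsym
    subst hsym
    cases hf
    refine ⟨rfl, by simpa using hl, 0, 0, fun _ => 0, .refl _, ?_, by simp, by simp, ?_⟩
    · simpa using hF.decode_eq_zero
    · simp only [costBefore]; omega
  | accept =>
    obtain ⟨rfl, rfl, rfl⟩ := sweep_idle hsw
    obtain ⟨rfl, hl, t, B, P, hr, -, hB, -, hm⟩ := h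
    cases hf
    exact ⟨by simpa using hl, t, B, _, hr, rfl, hB, by omega⟩
  | guess hne =>
    obtain ⟨q', rfl, rfl, h₁, h₂⟩ := sweep_guess hsw
    obtain ⟨rfl, hl, t, B, P, hr, hP, -, hB, hm⟩ := h
    cases hf
    simp only [Option.toList_none, List.append_nil]
    refine ⟨_, t, B, 0, ⟨hlen.trans hl, hr, hB hne, h₂, by simp, ?_⟩, ?_, fun _ => rfl, by simp,
      by simp, by simp; omega⟩
    · intro j _
      rw [decode_eq_of_map_pos_eq h₁]
      exact hP j
    · intro j _
      rw [decode_eq_of_map_pos_eq h₁]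
      simpa [HeadMove.onInput] using hP j
  | dec i q =>
    obtain ⟨c, t, B, a, hb, hj, hk, ha, hle, hm⟩ := h
    obtain ⟨c', rfl, rfl, h₁, h₂, h₃, h₄⟩ := sweep_dec hsw hle
    cases hf
    simp only [Option.toList_none, List.append_nil]
    simp only [Fin.val_castSucc] at hb hj hm
    refine ⟨c, t, B, a + 1, hb.congr h₂, ?_, ?_, ?_, h₁, ?_⟩
    · intro j hji
      obtain rfl : j = i := Fin.ext hji
      have := hj j rfl
      simp only [Bool.toNat_true, Bool.toNat_false, mul_zero, add_zero] at h₄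
      -- The counter lost one unit, worth `w.length` cells, which the input head has just crossed.
      rw [← this, decode, decode, h₃, ← h₄, hlen]
      simp only [HeadMove.onInput]
      ring
    · have := i.isLt
      simp only [Fin.val_castSucc]
      omega
    · simp only [HeadMove.onInput]
      rw [hb.length_eq, add_mul, ha, one_mul]
    · simp only [Fin.val_castSucc]; omega
  | fin i q =>
    obtain ⟨c, t, B, a, hb, hj, hk, ha, hle, hm⟩ := h
    obtain ⟨rfl, rfl, rfl, h₁⟩ := sweep_fin hsw
    cases hf
    simp only [Option.toList_none, List.append_nil]
    simp only [Fin.val_castSucc] at hb hj hm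
    have ha' : a ≤ (x.length + 1) / blockLen x.length := by
      rw [Nat.le_div_iff_mul_le hpos]; omega
    refine ⟨c, t, B, hb, ?_, h₁, by omega⟩
    rw [← hj i rfl, decode, h₁]
    simp [HeadMove.onInput]
  | done =>
    obtain ⟨rfl, rfl, rfl⟩ := sweep_idle hsw
    obtain ⟨c, t, B, a, hb, hj, hk, ha, hle, hm⟩ := h
    cases hf
    simp only [Option.toList_none, List.append_nil]
    obtain rfl : p' = 0 := hk rfl
    have ha0 : a = 0 := by simpa [hpos.ne'] using ha
    simp only [Fin.val_last] at hb hm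
    -- All heads agree with the guessed records, so only now does the block become a path of `M`.
    obtain ⟨t', ht', htl⟩ := reaches_of_runs hb.run (fun j => hb.done j j.isLt)
    have hfull := hb.full
    refine ⟨rfl, hb.length_eq, t + t', B + 1, _, hb.reach.trans ht', fun j => rfl, ?_, ?_, ?_⟩
    · rw [add_mul]; omega
    · intro hne
      have := htl hne
      simp only [recs, List.length_map, hb.length_eq] at this
      rw [add_mul]; omega
    · rw [costBefore_succ]; omega
  | ver =>
    obtain ⟨rfl, rfl, h₁⟩ := sweep_ver hsw
    rename_i i q
    obtain ⟨c, t, B, hb, hp, hz, hm⟩ := h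
    cases hf
    simp only [Option.toList_none, List.append_nil]
    simp only [HeadMove.onInput, hp] at h₁
    refine ⟨c, t, B, 0, hb, ?_, ?_, by omega⟩
    · simpa [hz] using h₁
    · simpa using h₁.le (pos_le_of_reaches hb.reach i)
  | inc =>
    rename_i i q
    obtain ⟨c', rfl, h₁, h₂, h₃⟩ := sweep_inc hsw
    obtain ⟨c, t, B, a, hb, hr, ha, hm⟩ := h
    cases hf
    simp only [Option.toList_none, List.append_nil]
    simp only [Bool.toNat_true, Bool.toNat_false, mul_zero, add_zero] at h₃
    simp only [HeadMove.onInput, hb.length_eq] at h₁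
    refine ⟨c, t, B, a + 1, hb.congr h₂, ?_, ?_, by omega⟩
    · rw [h₂.1, ← h₃]
      convert hr using 1
      rw [← h₁]; ring
    · rw [add_mul]; omega
  | finb =>
    rename_i i q
    obtain ⟨rfl, h₁, h₂, h₃⟩ := sweep_finb hsw
    obtain ⟨c, t, B, a, hb, hr, ha, hm⟩ := h
    cases hf
    simp only [Option.toList_none, List.append_nil]
    rw [inputCell_eq_leftEnd_iff] at hsym'
    subst hsym'
    have ha' : a ≤ (x.length + 1) / blockLen x.length := by
      rw [Nat.le_div_iff_mul_le hpos]; omega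
    simp only [HeadMove.onInput] at h₁
    have hb' := hb.congr h₂
    refine ⟨c, t, B, 0, ⟨hb'.length_eq, hb'.reach, hb'.full, hb'.run, ?_, ?_⟩, ?_, fun _ => rfl,
      by simp, by omega, ?_⟩
    · intro j hj
      rw [Fin.val_succ] at hj
      rcases Nat.lt_succ_iff_lt_or_eq.1 hj with hj | hj
      · exact hb'.done j hj
      · obtain rfl : j = i := Fin.ext hj
        rw [h₂.1, decode, h₃, hb'.length_eq]
        convert hr using 2
        omega
    · intro j hj
      rw [Fin.val_succ] at hj
      exact hb'.todo j (by omega)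
    · intro j hj
      rw [Fin.val_succ] at hj
      rw [zero_add]
      exact hb'.todo j (by omega)
    · rw [Fin.val_succ, add_mul, one_mul]
      have : headCost x.length = 2 * ((x.length + 1) / blockLen x.length) + 3 := rfl
      omega

theorem simInv_of_reaches {m : ℕ} {c : M.sim.Cfg} (h : ReachesIn (M.sim.Step x) m M.sim.init c) :
    SimInv M x m c.state c.inPos c.word := by
  generalize hc₀ : M.sim.init = c₀ at h
  induction h with
  | refl => subst hc₀; exact SimInv.init
  | tail _ hs ih => exact (ih hc₀).step hs

end TwoNFA

namespace TwoNFA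

variable {k : ℕ} {α : Type} {M : TwoNFA k α} {x : List α}

open Relation (ReflTransGen)

/-! ### Accepting paths are simulated -/

/-- Decrementing a positive counter never borrows past its top bit. -/
theorem carry_eq_false {c : Bool} {u v n : ℕ} (h : 1 + u = v + n * c.toNat) (hu : u < n)
    (hv : 0 < v) : c = false := by
  cases c
  · rfl
  · simp at h; omega

theorem binVal_bits_lt (i : Fin k) (w : List (Cell k α)) : binVal (bits i w) < 2 ^ w.length := by
  simpa [bits] using binVal_lt (bits i w)

theorem SameOff.length_eq {i : Fin k} {w w' : List (Cell k α)} (h : SameOff i w w') :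
    w'.length = w.length := by
  simpa [recs] using congrArg List.length h.1

theorem SameOff.refl (i : Fin k) (w : List (Cell k α)) : SameOff i w w :=
  ⟨rfl, fun _ _ => ⟨rfl, rfl⟩⟩

variable [Finite α]

theorem sim_step {r r' : M.Ctl} {p p' : ℕ} {w w' : List (Cell k α)} {a a' : M.Swp} {mv : HeadMove}
    (hr : r ≠ .acc) (hst : M.SimStart r (inputCell x p) a mv)
    (hsw : M.sim.Sweep x a (mv.onInput x.length p) w a' p' w')
    (hf : M.SimFinish a' (inputCell x p') r' none) :
    M.sim.Step x ⟨r, p, w⟩ ⟨r', p', w'⟩ :=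
  ⟨hr, a, mv, a', w', none, hst, hsw, hf, by simp⟩

/-- The correct choices are to decrement while the counter is positive and then to spend the marks.
The right marker never blocks the walk, since the target `P` lies on the tape. -/
theorem reaches_verify (i : Fin k) (q : M.Q) {p P : ℕ} {w : List (Cell k α)}
    (hP : p + decode i w = P) (hle : P ≤ x.length + 1) :
    ∃ w', ReflTransGen (M.sim.Step x) ⟨.walk i.castSucc q, p, w⟩ ⟨.verify i q, P, w'⟩ ∧
      SameOff i w w' ∧ binVal (bits i w') = 0 := by
  generalize hv : binVal (bits i w) = v
  induction v generalizing p w with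
  | zero =>
    rw [decode, hv, zero_mul, zero_add] at hP
    obtain ⟨p', hs⟩ := exists_sweep_fin (x := x) i q hv (hP.trans_le hle)
    obtain ⟨-, -, rfl, -⟩ := sweep_fin hs
    rw [hP] at hs
    exact ⟨w, .single (sim_step nofun (SimStart.fin i q) hs SimFinish.fin), .refl i w, hv⟩
  | succ v ih =>
    rw [decode, hv, add_mul, one_mul] at hP
    obtain ⟨c', p', w', hs⟩ := exists_sweep_dec (M := M) (x := x) i true q (p := p) (w := w)
      (by omega)
    obtain ⟨c', hc, rfl, h₁, h₂, h₃, h₄⟩ := sweep_dec hs (by omega)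
    cases hc
    have hlt := binVal_bits_lt i w'
    rw [h₂.length_eq] at hlt
    rw [hv, Bool.toNat_true] at h₄
    obtain rfl := carry_eq_false h₄ hlt v.succ_pos
    simp only [Bool.toNat_false, mul_zero, add_zero] at h₄
    have hv' : binVal (bits i w') = v := by omega
    obtain ⟨w'', h₅, h₆, h₇⟩ := ih (p := p + w.length) (w := w')
      (by rw [decode, hv', h₃, h₂.length_eq]; omega) hv'
    exact ⟨w'', .head (sim_step nofun (SimStart.dec i q) hs SimFinish.dec) h₅, h₂.trans h₆, h₇⟩

theorem reaches_walk_succ (i : Fin k) (q : M.Q) {p P : ℕ} {w : List (Cell k α)}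
    (hl : w.length = blockLen x.length) (hP : binVal (bits i w) * w.length + p = P)
    (hle : P ≤ x.length + 1) :
    ∃ w', ReflTransGen (M.sim.Step x) ⟨.back i q, p, w⟩ ⟨.walk i.succ q, 0, w'⟩ ∧
      SameOff i w w' ∧ decode i w' = P := by
  have hpos := blockLen_pos x.length
  induction p using Nat.strong_induction_on generalizing w with
  | _ p ih =>
    -- A remainder up to `w.length` fits into the marks; a larger distance leaves room for one more
    -- full sweep to the left.
    rcases le_or_gt p w.length with hp | hp
    · obtain ⟨w', hs⟩ := exists_sweep_finb (M := M) (x := x) i q hp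
      obtain ⟨-, h₁, h₂, h₃⟩ := sweep_finb hs
      refine ⟨w', .single (sim_step nofun SimStart.finb hs SimFinish.finb), h₂, ?_⟩
      rw [decode, h₃, h₂.length_eq]
      omega
    · obtain ⟨c', p', w', hs⟩ := exists_sweep_inc (M := M) (x := x) i true q hp.le
      obtain ⟨c', hc, h₁, h₂, h₃⟩ := sweep_inc hs
      cases hc
      rw [Bool.toNat_true] at h₃
      -- The block length is chosen so that `blockLen` bits hold every tape position; the increment
      -- therefore cannot overflow.
      have hsize : x.length + 1 < 2 ^ w.length := by
        rw [hl]; exact Nat.lt_size_self _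
      have hval : 1 + binVal (bits i w) ≤ P := by
        have : binVal (bits i w) * 1 ≤ binVal (bits i w) * w.length :=
          Nat.mul_le_mul_left _ (by omega)
        omega
      have hc' : c' = false := by
        cases c'
        · rfl
        · simp at h₃; omega
      subst hc'
      simp only [Bool.toNat_false, mul_zero, add_zero] at h₃
      obtain ⟨w'', h₄, h₅, h₆⟩ := ih p' (by omega) (w := w') (h₂.length_eq.trans hl)
        (by rw [← h₃, h₂.length_eq, ← hP, ← h₁]; ring)
      exact ⟨w'', .head (sim_step nofun SimStart.inc hs SimFinish.inc) h₄, h₂.trans h₅, h₆⟩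

/-- One head is processed. -/
theorem reaches_head (i : Fin k) (q : M.Q) {P' : ℕ} {w : List (Cell k α)}
    (hl : w.length = blockLen x.length) (hle : decode i w ≤ x.length + 1)
    (hr : HeadRun x i (decode i w) (recs w) P') :
    ∃ w', ReflTransGen (M.sim.Step x) ⟨.walk i.castSucc q, 0, w⟩ ⟨.walk i.succ q, 0, w'⟩ ∧
      SameOff i w w' ∧ decode i w' = P' := by
  obtain ⟨w₁, h₁, h₂, h₃⟩ := reaches_verify (M := M) i q (zero_add _) hle
  have hr₁ := hr
  rw [← h₂.1] at hr₁
  have h₄ := sim_step (M := M) (r := .verify i q) nofun SimStart.ver (exists_sweep_ver q hr₁)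
    SimFinish.ver
  obtain ⟨w₂, h₅, h₆, h₇⟩ := reaches_walk_succ (M := M) i q (h₂.length_eq.trans hl)
    (by rw [h₃, zero_mul, zero_add]) (hr.le hle)
  exact ⟨w₂, (h₁.tail h₄).trans h₅, h₂.trans h₆, h₇⟩

/-- The heads are processed one after the other. -/
theorem reaches_heads (q : M.Q) {P' : Fin k → ℕ} {w : List (Cell k α)}
    (hl : w.length = blockLen x.length) (hle : ∀ i, decode i w ≤ x.length + 1)
    (hr : ∀ i, HeadRun x i (decode i w) (recs w) (P' i)) (i : Fin (k + 1)) :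
    ∃ w', ReflTransGen (M.sim.Step x) ⟨.walk 0 q, 0, w⟩ ⟨.walk i q, 0, w'⟩ ∧
      recs w' = recs w ∧ (∀ j : Fin k, j.castSucc < i → decode j w' = P' j) ∧
      ∀ j : Fin k, i ≤ j.castSucc → decode j w' = decode j w := by
  induction i using Fin.induction with
  | zero => exact ⟨w, .refl, rfl, fun j hj => absurd hj (Fin.not_lt_zero _), fun _ _ => rfl⟩
  | succ i ih =>
    obtain ⟨w₁, h₁, h₂, h₃, h₄⟩ := ih
    have hl₁ : w₁.length = blockLen x.length := by
      rw [← hl]; simpa [recs] using congrArg List.length h₂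
    have hi := h₄ i le_rfl
    obtain ⟨w₂, h₅, h₆, h₇⟩ := reaches_head (M := M) (x := x) (w := w₁) i q (P' := P' i) hl₁
      (hi ▸ hle i) (by rw [hi, h₂]; exact hr i)
    refine ⟨w₂, h₁.trans h₅, h₆.1.trans h₂, fun j hj => ?_, fun j hj => ?_⟩
    · rcases eq_or_ne j i with rfl | hne
      · exact h₇
      · rw [h₆.decode_eq hne]
        refine h₃ j ?_
        simp only [Fin.lt_def, Fin.val_castSucc, Fin.val_succ, ne_eq, Fin.ext_iff] at *
        omega
    · have hlt : i < j := by
        simp only [Fin.le_def, Fin.lt_def, Fin.val_castSucc, Fin.val_succ] at *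
        omega
      rw [h₆.decode_eq hlt.ne']
      exact h₄ j (Fin.castSucc_le_castSucc_iff.2 hlt.le)

/-- One block is simulated. -/
theorem reaches_block {q q' : M.Q} (hq : q ≠ M.qacc) {P' : Fin k → ℕ} {w : List (Cell k α)}
    {l : List (Option (StepRecord k α))} (hw : w.length = blockLen x.length)
    (hl : l.length = blockLen x.length) (hle : ∀ i, decode i w ≤ x.length + 1)
    (hs : StateRun M q l q') (hr : ∀ i, HeadRun x i (decode i w) l (P' i)) :
    ∃ w', ReflTransGen (M.sim.Step x) ⟨.main q, 0, w⟩ ⟨.main q', 0, w'⟩ ∧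
      w'.length = blockLen x.length ∧ ∀ i, decode i w' = P' i := by
  obtain ⟨w₁, h₁, h₂⟩ := exists_sweep_guess (x := x) 0 hs (hl.trans hw.symm)
  obtain ⟨-, -, -, h₃, -⟩ := sweep_guess h₁
  have hd := decode_eq_of_map_pos_eq h₃
  obtain ⟨w₂, h₄, h₅, h₆, -⟩ := reaches_heads (M := M) (x := x) (w := w₁) q' (P' := P')
    (h₁.length_eq.trans hw) (fun i => hd i ▸ hle i) (fun i => by rw [hd, h₂]; exact hr i)
    (Fin.last k)
  refine ⟨w₂, .head (sim_step nofun (SimStart.guess hq) h₁ SimFinish.guess)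
    (h₄.tail (sim_step nofun SimStart.done (exists_sweep_idle _ _ _) SimFinish.idle)), ?_, ?_⟩
  · rw [← hl, ← h₂]
    simpa [recs] using congrArg List.length h₅
  · exact fun i => h₆ i (Fin.castSucc_lt_last i)

/-- An accepting path is cut into blocks of exactly `blockLen` steps, except that the last may be
shorter: its records are padded, which is allowed because it ends in the accept state. -/
theorem reaches_acc {t : ℕ} {c d : M.Cfg} {w : List (Cell k α)}
    (hw : w.length = blockLen x.length) (hc : ∀ i, decode i w = c.pos i)
    (hle : ∀ i, c.pos i ≤ x.length + 1) (h : ReachesIn (M.Step x) t c d)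
    (hd : d.state = M.qacc) :
    ∃ w', ReflTransGen (M.sim.Step x) ⟨.main c.state, 0, w⟩ ⟨.acc, 0, w'⟩ := by
  induction t using Nat.strong_induction_on generalizing c w with
  | _ t ih =>
    have hpos := blockLen_pos x.length
    by_cases hq : c.state = M.qacc
    · rw [hq]
      exact ⟨w, .single (sim_step nofun SimStart.accept (exists_sweep_idle _ _ _) SimFinish.idle)⟩
    · have ht : 0 < t := by
        rcases Nat.eq_zero_or_pos t with rfl | ht
        · cases h; exact absurd hd hq
        · exact ht
      obtain ⟨s, r, e, hst, hs, hre, hbl⟩ : ∃ s r e, s + r = t ∧ ReachesIn (M.Step x) s c e ∧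
          ReachesIn (M.Step x) r e d ∧
          (s = blockLen x.length ∨ s ≤ blockLen x.length ∧ e = d ∧ r = 0) := by
        rcases le_or_gt t (blockLen x.length) with hle | hgt
        · exact ⟨t, 0, d, rfl, h, .refl d, .inr ⟨hle, rfl, rfl⟩⟩
        · obtain ⟨r, rfl⟩ := Nat.exists_eq_add_of_le hgt.le
          obtain ⟨e, h₁, h₂⟩ := h.split
          exact ⟨_, r, e, rfl, h₁, h₂, .inl rfl⟩
      obtain ⟨l, hl, hrun, hhead⟩ := runs_of_reaches (n := blockLen x.length) hs
        (hbl.imp id fun ⟨h₁, h₂, _⟩ => ⟨h₁, h₂ ▸ hd⟩)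
      obtain ⟨w', h₁, h₂, h₃⟩ := reaches_block (P' := e.pos) hq hw hl
        (fun i => hc i ▸ hle i) hrun (fun i => by rw [hc]; exact hhead i)
      obtain ⟨w'', h₄⟩ := ih r (by omega) h₂ h₃ (fun i => (hhead i).le (hle i)) hre
      exact ⟨w'', h₁.trans h₄⟩

theorem reaches_setup {p : ℕ} (hp : p ≤ x.length + 1) :
    ∃ w, ReflTransGen (M.sim.Step x) M.sim.init ⟨.setup, p, w⟩ := by
  induction p with
  | zero => exact ⟨[], .refl⟩
  | succ p ih =>
    obtain ⟨w, h⟩ := ih (by omega)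
    obtain ⟨c, w', hs⟩ := exists_sweep_count (M := M) (x := x) true (p + 1) w
    have hne : inputCell x p ≠ .rightEnd := by
      rw [ne_eq, inputCell_eq_rightEnd_iff]; omega
    rw [← (HeadMove.right_onInput hne).1] at hs ⊢
    cases c with
    | false => exact ⟨w', h.tail (sim_step nofun (SimStart.count hne) hs SimFinish.count)⟩
    | true => exact ⟨_, h.tail ⟨nofun, _, _, _, _, _, SimStart.count hne, hs, SimFinish.extend, rfl⟩⟩

theorem reaches_rewound (p : ℕ) (w : List (Cell k α)) :
    ReflTransGen (M.sim.Step x) ⟨.rewind, p, w⟩ ⟨.main M.q₀, 0, w⟩ := by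
  induction p with
  | zero =>
    exact .single (sim_step nofun SimStart.rewound (exists_sweep_idle _ _ _) SimFinish.idle)
  | succ p ih =>
    have hne : inputCell x (p + 1) ≠ .leftEnd := by simp [inputCell_eq_leftEnd_iff]
    exact .head (sim_step nofun (SimStart.rewind hne) (exists_sweep_idle _ _ _) SimFinish.idle) ih

theorem sim_reaches_acc (h : M.Accepts x) :
    ∃ c, ReflTransGen (M.sim.Step x) M.sim.init c ∧ c.state = .acc := by
  obtain ⟨t, d, hr, hd⟩ := h
  obtain ⟨w, h₁⟩ := reaches_setup (M := M) (x := x) le_rfl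
  obtain ⟨m, hm⟩ := ReachesIn.iff_reflTransGen.2 h₁
  -- The soundness invariant also supplies the length and freshness of the word that the setup
  -- produces.
  obtain ⟨hF, hl, -⟩ := simInv_of_reaches hm
  have hR : inputCell x (x.length + 1) = .rightEnd := by simp [inputCell_eq_rightEnd_iff]
  have h₂ : M.sim.Step x ⟨.setup, x.length + 1, w⟩ ⟨.rewind, x.length + 1, w⟩ :=
    sim_step nofun (hR ▸ SimStart.counted) (exists_sweep_idle _ _ _) SimFinish.idle
  obtain ⟨w', h₃⟩ := reaches_acc (M := M) (c := M.init) hl (fun i => hF.decode_eq_zero i)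
    (fun i => Nat.zero_le _) hr hd
  exact ⟨_, ((h₁.tail h₂).trans (reaches_rewound _ _)).trans h₃, rfl⟩

theorem accepts_of_sim_reaches {m : ℕ} {c : M.sim.Cfg}
    (h : ReachesIn (M.sim.Step x) m M.sim.init c) (hc : c.state = .acc) : M.Accepts x := by
  have := simInv_of_reaches h
  rw [hc] at this
  obtain ⟨-, t, B, d, hr, hd, -⟩ := this
  exact ⟨t, d, hr, hd⟩

theorem sim_bounds {T : ℕ → ℕ} (hT : M.RunsInTime T) {m : ℕ} {c : M.sim.Cfg}
    (h : ReachesIn (M.sim.Step x) m M.sim.init c) :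
    c.word.length ≤ blockLen x.length ∧
      m ≤ costBefore k x.length (T x.length / blockLen x.length + 1) + 1 :=
  (simInv_of_reaches h).bounds (hT x)

variable (M) in
theorem sim_language {T : ℕ → ℕ} (hT : M.RunsInTime T) : M.sim.toNTM.language = M.language := by
  ext x
  constructor
  · intro h
    obtain ⟨m, c, hm, hc⟩ :=
      Sweeper.reaches_of_accepts (x := x) (show Ctl.setup ≠ Ctl.acc from nofun) (fun m c hm => (sim_bounds hT hm).1) h
    exact accepts_of_sim_reaches hm hc
  · intro h
    obtain ⟨c, hc, hq⟩ := sim_reaches_acc h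
    exact Sweeper.accepts_of_reaches (show Ctl.setup ≠ Ctl.acc from nofun) hc hq

end TwoNFA

/-! ### The resource bounds -/

section Asymptotics

open Filter Asymptotics Real TwoNFA

theorem log_le_blockLen (n : ℕ) : log n ≤ blockLen n := by
  rcases Nat.eq_zero_or_pos n with rfl | hn
  · simp
  have h₁ : (n : ℝ) ≤ 2 ^ blockLen n := by
    exact_mod_cast (Nat.le_succ n).trans (Nat.lt_size_self (n + 1)).le
  have h₂ : log n ≤ blockLen n * log 2 := by
    rw [← log_pow]
    exact log_le_log (by exact_mod_cast hn) h₁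
  have h₃ : log 2 ≤ 1 := log_two_lt_d9.le.trans (by norm_num)
  exact h₂.trans (mul_le_of_le_one_right (Nat.cast_nonneg _) h₃)

theorem tendsto_log_natCast : Tendsto (fun n : ℕ => log n) atTop atTop :=
  tendsto_log_atTop.comp tendsto_natCast_atTop_atTop

theorem one_isBigO_log : (fun _ : ℕ => (1 : ℝ)) =O[atTop] fun n : ℕ => log n :=
  ((isLittleO_const_left.2 (.inr (tendsto_norm_atTop_atTop.comp tendsto_log_natCast)))).isBigO

theorem blockLen_isBigO_log : (fun n => (blockLen n : ℝ)) =O[atTop] fun n : ℕ => log n := by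
  -- From `2 ^ (blockLen n - 1) ≤ n + 1 ≤ 2 * n` by taking logarithms; the factor `2` comes from
  -- `log 2 ≥ 1 / 2`.
  have hb : ∀ n : ℕ, 1 ≤ n → (blockLen n : ℝ) ≤ 1 + (1 + 2 * log n) := by
    intro n hn
    have hn' : (1 : ℝ) ≤ n := by exact_mod_cast hn
    obtain ⟨l, hl⟩ : ∃ l, blockLen n = l + 1 :=
      ⟨blockLen n - 1, by have := blockLen_pos n; omega⟩
    have h₁ : 2 ^ l ≤ n + 1 := Nat.lt_size.1 (show l < (n + 1).size by
      change l < blockLen n; omega)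
    have h₂ : (2 : ℝ) ^ l ≤ 2 * n := by
      have : (2 : ℝ) ^ l ≤ n + 1 := by exact_mod_cast h₁
      linarith
    have h₃ : l * log 2 ≤ log 2 + log n := by
      rw [← log_pow, ← log_mul (by norm_num) (by positivity)]
      exact log_le_log (by positivity) h₂
    have h₄ : (0.5 : ℝ) ≤ log 2 := by linarith [log_two_gt_d9]
    have h₅ := log_nonneg hn'
    rw [hl]
    push_cast
    nlinarith
  have h := one_isBigO_log.add (one_isBigO_log.add
    ((isBigO_refl (fun n : ℕ => log n) atTop).const_mul_left 2))
  refine IsBigO.trans (IsBigO.of_norm_eventuallyLE ?_) h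
  filter_upwards [eventually_ge_atTop 1] with n hn
  rw [norm_of_nonneg (Nat.cast_nonneg _)]
  exact hb n hn

/-- Division by the block length saves a logarithmic factor. -/
theorem div_blockLen_isBigO {f : ℕ → ℕ} (hf : (fun n => (f n : ℝ)) =O[atTop] fun n => (n : ℝ)) :
    (fun n => ((f n / blockLen n : ℕ) : ℝ)) =O[atTop] fun n : ℕ => (n : ℝ) / log n := by
  have h : (fun n : ℕ => (f n : ℝ) / log n) =O[atTop] fun n : ℕ => (n : ℝ) / log n := by
    simp only [div_eq_mul_inv]
    exact hf.mul (isBigO_refl _ _)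
  refine IsBigO.trans (IsBigO.of_norm_eventuallyLE ?_) h
  filter_upwards [tendsto_log_natCast.eventually_gt_atTop 0] with n hn
  rw [norm_of_nonneg (Nat.cast_nonneg _)]
  exact Nat.cast_div_le.trans
    (div_le_div_of_nonneg_left (Nat.cast_nonneg _) hn (log_le_blockLen n))

theorem one_isBigO_div_log :
    (fun _ : ℕ => (1 : ℝ)) =O[atTop] fun n : ℕ => (n : ℝ) / log n := by
  refine IsBigO.of_norm_eventuallyLE ?_
  filter_upwards [tendsto_log_natCast.eventually_gt_atTop 0] with n hn
  rw [norm_one, one_le_div hn]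
  exact log_le_self (Nat.cast_nonneg n)

/-- Since `log n ^ 2 = O(n)`, the linearly many sweeps of the setup and the rewinding are absorbed
by the main term. -/
theorem natCast_isBigO_div_log_sq :
    (fun n : ℕ => (n : ℝ)) =O[atTop] fun n : ℕ => ((n : ℝ) / log n) * ((n : ℝ) / log n) := by
  have h : (fun n : ℕ => log n ^ 2) =O[atTop] fun n : ℕ => (n : ℝ) :=
    ((isLittleO_pow_log_id_atTop (n := 2)).comp_tendsto tendsto_natCast_atTop_atTop).isBigO
  have h' := h.mul (isBigO_refl (fun n : ℕ => (n : ℝ) / log n ^ 2) atTop)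
  refine (h'.congr' ?_ ?_)
  · filter_upwards [tendsto_log_natCast.eventually_gt_atTop 0] with n hn
    field_simp
  · exact .of_forall fun n => by ring

theorem natCast_add_one_isBigO : (fun n : ℕ => ((n + 1 : ℕ) : ℝ)) =O[atTop] fun n => (n : ℝ) := by
  refine IsBigO.of_bound 2 ?_
  filter_upwards [eventually_ge_atTop 1] with n hn
  have : (1 : ℝ) ≤ n := by exact_mod_cast hn
  rw [norm_of_nonneg (Nat.cast_nonneg _), norm_of_nonneg (Nat.cast_nonneg _)]
  push_cast
  linarith

theorem costBefore_isBigO (k : ℕ) {T : ℕ → ℕ}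
    (hT : (fun n => (T n : ℝ)) =O[atTop] fun n => (n : ℝ)) :
    (fun n => (costBefore k n (T n / blockLen n + 1) : ℝ)) =O[atTop]
      fun n : ℕ => ((n : ℝ) / log n) * ((n : ℝ) / log n) := by
  have hone := one_isBigO_div_log
  have hconst : ∀ c : ℝ, (fun _ : ℕ => c) =O[atTop] fun n : ℕ => (n : ℝ) / log n := fun c => by
    simpa using hone.const_mul_left c
  have hhead : (fun n => (headCost n : ℝ)) =O[atTop] fun n : ℕ => (n : ℝ) / log n := by
    have := ((div_blockLen_isBigO natCast_add_one_isBigO).const_mul_left 2).add (hconst 3)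
    exact this.congr_left fun n => by simp only [headCost]; push_cast; ring
  have hblock : (fun n => (blockCost k n : ℝ)) =O[atTop] fun n : ℕ => (n : ℝ) / log n :=
    ((hhead.const_mul_left k).add (hconst 2)).congr_left fun n => by
      simp only [blockCost]; push_cast; ring
  have hB := (div_blockLen_isBigO hT).add hone
  have := ((natCast_isBigO_div_log_sq.const_mul_left 2).add
    (by simpa using (hconst 4).mul hone)).add (hB.mul hblock)
  exact this.congr_left fun n => by simp only [costBefore]; push_cast; ring

theorem sim_time_isBigO (k : ℕ) {T : ℕ → ℕ}
    (hT : (fun n => (T n : ℝ)) =O[atTop] fun n => (n : ℝ)) :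
    (fun n => (((costBefore k n (T n / blockLen n + 1) + 1 + 1) *
      (2 * blockLen n + 2) + 1 : ℕ) : ℝ)) =O[atTop] fun n : ℕ => (n : ℝ) ^ 2 / log n := by
  have h₁ : (fun _ : ℕ => (1 : ℝ)) =O[atTop]
      fun n : ℕ => ((n : ℝ) / log n) * ((n : ℝ) / log n) := by
    simpa using one_isBigO_div_log.mul one_isBigO_div_log
  have h₂ := ((costBefore_isBigO k hT).add (h₁.const_mul_left 2)).mul
    ((blockLen_isBigO_log.const_mul_left 2).add (one_isBigO_log.const_mul_left 2))
  have h₃ := h₂.add (by simpa using h₁.mul one_isBigO_log)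
  refine h₃.congr (fun n => by push_cast; ring) fun n => ?_
  -- When `log n = 0`, division by zero makes both sides `0`, so the two bounding functions agree
  -- everywhere.
  rcases eq_or_ne (log n) 0 with h | h
  · simp [h]
  · field_simp

theorem sim_space_isBigO :
    (fun n => ((blockLen n + 2 : ℕ) : ℝ)) =O[atTop] fun n : ℕ => log n :=
  (blockLen_isBigO_log.add (one_isBigO_log.const_mul_left 2)).congr_left
    fun n => by push_cast; ring

end Asymptotics

/-! ### The inclusion of the classes -/

theorem mainTheorem2 (α : Type) [Finite α] :
    MultiheadNFATime α (fun n => (n : ℝ)) ⊆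
      NTISP α (fun n => (n : ℝ) ^ 2 / Real.log n) (fun n => Real.log n) := by
  rintro L ⟨k, -, M, T, rfl, hT, hO⟩
  exact ⟨M.sim.toNTM, _, _, M.sim_language hT,
    fun x t c h => (Sweeper.runs_bounds (fun m c hm => TwoNFA.sim_bounds hT hm) h).1,
    fun x t c h => (Sweeper.runs_bounds (fun m c hm => TwoNFA.sim_bounds hT hm) h).2,
    sim_time_isBigO k hO, sim_space_isBigO⟩
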